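/- Let $S$ be a closed surface, i.e. a nonempty compact connected Hausdorff topological $2$-manifold without boundary, and let $K$ be a triangulation of $S$, i.e. a finite simplicial complex whose geometric realization is homeomorphic to $S$. For a nonempty finite simplicial complex $T$ let $f_i(T)$ be the number of its $i$-dimensional faces, let $\mu_i(T) = f_0(T)/f_i(T)\in(0,\infty]$ (with $\mu_i(T)=\infty$ if $f_i(T)=0$), and for $r\ge 0$ let $$\mu(T)=\Big\{(\alpha_1,\dots,\alpha_r)\in\mathbf R^r:\ \sum_{i=1}^r \frac{\alpha_i}{\mu_i(T)}<1,\ \alpha_i\ge 0\Big\}.$$ An $r$-dimensional finite simplicial complex $K$ is called balanced if $\bigcap_{T}\mu(T)=\mu(K)$, where $T$ runs over all nonempty subcomplexes of $K$. Suppose that $\chi(S)=\sum_i(-1)^i f_i(K)\ge 0$. Then $K$ is ($2$-dimensional and) balanced. Equivalently, every nonempty subcomplex $T\subset K$ satisfies $\mu_i(T)\ge\mu_i(K)$ for $i=1,2$. -/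

import Mathlib

open scoped ENNReal

/-! Finite simplicial complexes are abstract simplicial complexes on a finite type `V` of potential
vertices; the vertices of `K` are the `v : V` with `{v} ∈ K.faces`.  Faces are nonempty, and
`T ≤ K` says that `T` is a subcomplex of `K`. -/

namespace PreAbstractSimplicialComplex

variable {V : Type*}

/-- The number `f_i(K)` of `i`-dimensional faces of `K`. -/
noncomputable def faceCount (K : PreAbstractSimplicialComplex V) (i : ℕ) : ℕ :=
  {s : Finset V | s ∈ K.faces ∧ s.card = i + 1}.ncard

/-- `K` has dimension `r`. -/
def HasDimension (K : PreAbstractSimplicialComplex V) (r : ℕ) : Prop :=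
  IsGreatest {n : ℕ | ∃ s ∈ K.faces, s.card = n + 1} r

/-- The Euler characteristic `χ(K) = ∑_i (-1)^i f_i(K)`; a face has dimension less than the number
of elements of `V`. -/
noncomputable def eulerChar [Fintype V] (K : PreAbstractSimplicialComplex V) : ℤ :=
  ∑ i ∈ Finset.range (Fintype.card V), (-1) ^ i * (K.faceCount i : ℤ)

/-- The geometric realization of `K`, in barycentric coordinates, as a subspace of `V → ℝ`: the
union, over the faces `s` of `K`, of the faces of the standard simplex spanned by `s`. -/
def realization [Fintype V] (K : PreAbstractSimplicialComplex V) : Set (V → ℝ) :=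
  {x | x ∈ stdSimplex ℝ V ∧ ∃ s ∈ K.faces, ∀ v, x v ≠ 0 → v ∈ s}

/-- The density invariant `μ_i(K) = f_0(K) / f_i(K)`.  For `K` nonempty it is positive, and it is
`∞` exactly when `f_i(K) = 0`. -/
noncomputable def density (K : PreAbstractSimplicialComplex V) (i : ℕ) : ℝ≥0∞ :=
  (K.faceCount 0 : ℝ≥0∞) / (K.faceCount i : ℝ≥0∞)

/-- The domain `μ(K) = {(α_1, …, α_r) | ∑ α_i / μ_i(K) < 1, α_i ≥ 0}` in `ℝ^r`.  The coordinate
`α_{i+1}` is `α i`; in `ℝ≥0∞` a finite number divided by `∞` is `0`. -/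
def densityDomain (r : ℕ) (K : PreAbstractSimplicialComplex V) : Set (Fin r → ℝ) :=
  {α | (∀ i, 0 ≤ α i) ∧ ∑ i : Fin r, ENNReal.ofReal (α i) / K.density (i + 1) < 1}

/-- The reduced density domain: the intersection of the domains `μ(T)` over all nonempty
subcomplexes `T` of `K`. -/
def reducedDensityDomain (r : ℕ) (K : PreAbstractSimplicialComplex V) : Set (Fin r → ℝ) :=
  {α | ∀ T : PreAbstractSimplicialComplex V, T ≤ K → T.faces.Nonempty → α ∈ T.densityDomain r}

/-- `K` is an `r`-dimensional balanced simplicial complex. -/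
def IsBalanced (r : ℕ) (K : PreAbstractSimplicialComplex V) : Prop :=
  K.HasDimension r ∧ K.reducedDensityDomain r = K.densityDomain r

end PreAbstractSimplicialComplex

/-!
Write `f_i` for the number of `i`-dimensional faces of the triangulation `K`. Two steps lead from
the topology of the surface to the inequalities between densities.

*From topology to combinatorics.* The main topological tool is a bare-hands version of first
cohomology: a set has logarithms (`HasLogs`) if every continuous complex function without zeros on
it is an exponential. On a punctured disc every such function is `z ^ n * exp h`
(`exists_eq_zpow_mul_exp`), and `z ^ n` has no logarithm on the unit circle unless `n = 0`
(`eq_zero_of_zpow_eq_exp`). So the small punctured neighbourhoods of a point of a surface have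
"first cohomology of rank one". Testing this at barycentres of faces excludes rank zero
(`not_planarAt_of_hasLogs`), which occurs for maximal faces of dimension `0`, `1` or at least `3`
and for edges in exactly one triangle, and rank at least two (`not_planarAt_of_two_loops`), which
occurs for edges in three or more triangles. Hence all maximal faces are triangles and every edge is
in exactly two of them. Since finitely many points do not separate a connected surface
(`eq_univ_or_eq_univ_of_finite_inter`), any two triangles are joined by a chain of triangles with
consecutive members sharing an edge. This is `IsClosedTriangulation`.

*Counting.* Let `B` be a set of vertices. Let `e'` be the number of edges which meet `B`, let `t₁`
be the number of triangles with exactly one vertex in `B`, and let `χ_B` be the Euler characteristic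
of the subcomplex spanned by `B`. Double counting of incidences gives `e' = 3 |B| + t₁ - 3 χ_B`, and
`f_1 = 3 f_0 - 3 χ ≤ 3 f_0`. If `B` is connected and proper then `χ_B ≤ 1`
(`card_add_card_triangles_le`), so `e' / |B| ≥ 3 ≥ f_1 / f_0` as soon as `t₁ ≥ 3`. If `t₁ ≤ 2`, a
parity argument shows that at most one edge misses `B` (`card_edges_zero_le_one`), and
`e' / |B| ≥ f_1 / f_0` holds trivially. Applied to the set `B` of vertices outside a subcomplex `T`,
this says `f_1(T) / f_0(T) ≤ f_1 / f_0`, and the inequality for triangles follows from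
`3 f_2(T) ≤ 2 f_1(T)` and `3 f_2 = 2 f_1`.
-/

section Combinatorics

open Finset

/-! ### Counting in triangulated closed surfaces -/

lemma Finset.powersetCard_two_triple {V : Type*} [DecidableEq V] {x y z : V}
    (hxy : x ≠ y) (hxz : x ≠ z) (hyz : y ≠ z) :
    powersetCard 2 {x, y, z} = {{x, y}, {x, z}, {y, z}} := by
  ext e
  rw [mem_powersetCard, card_eq_two]
  constructor
  · rintro ⟨h, a, b, hab, rfl⟩
    have ha := h (mem_insert_self a _)
    have hb := h (mem_insert_of_mem (mem_singleton_self b))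
    simp only [mem_insert, mem_singleton] at ha hb ⊢
    rcases ha with rfl | rfl | rfl <;> rcases hb with rfl | rfl | rfl <;>
      simp_all [pair_comm]
  · intro h
    simp only [mem_insert, mem_singleton] at h
    rcases h with rfl | rfl | rfl
    · exact ⟨by simp [insert_subset_iff], x, y, hxy, rfl⟩
    · exact ⟨by simp [insert_subset_iff], x, z, hxz, rfl⟩
    · exact ⟨by simp, y, z, hyz, rfl⟩

lemma Finset.sum_powersetCard_two_triple {V M : Type*} [DecidableEq V] [AddCommMonoid M] {x y z : V}
    (hxy : x ≠ y) (hxz : x ≠ z) (hyz : y ≠ z) (f : Finset V → M) :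
    ∑ e ∈ powersetCard 2 {x, y, z}, f e = f {x, y} + (f {x, z} + f {y, z}) := by
  rw [powersetCard_two_triple hxy hxz hyz, sum_insert, sum_insert, sum_singleton]
  · rw [mem_singleton, Finset.ext_iff]
    intro h
    have := h x
    simp_all
  · simp only [mem_insert, mem_singleton, Finset.ext_iff, not_or]
    constructor
    · intro h
      have := h y
      simp_all
    · intro h
      have := h x
      simp_all

/-- The combinatorial data of a triangulated closed surface with vertex set `P`, edge set `E` and
triangle set `T`: every edge lies in exactly two triangles, every vertex lies in a triangle, and the
triangles are connected through edges, in the sense that a nonempty set of triangles which contains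
all triangles sharing an edge with one of its members is everything. Vertex links may be
disconnected. -/
structure IsClosedTriangulation {V : Type*} [DecidableEq V]
    (P : Finset V) (E T : Finset (Finset V)) : Prop where
  card_edge : ∀ e ∈ E, #e = 2
  card_triangle : ∀ t ∈ T, #t = 3
  mem_edges : ∀ t ∈ T, ∀ e ⊆ t, #e = 2 → e ∈ E
  triangle_subset : ∀ t ∈ T, t ⊆ P
  exists_triangle : ∀ v ∈ P, ∃ t ∈ T, v ∈ t
  card_triangles_edge : ∀ e ∈ E, #{t ∈ T | e ⊆ t} = 2
  eq_of_closed : ∀ F ⊆ T, F.Nonempty →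
    (∀ s ∈ F, ∀ t ∈ T, ∀ e ∈ E, e ⊆ s → e ⊆ t → t ∈ F) → F = T

namespace IsClosedTriangulation

variable {V : Type*} [DecidableEq V] {P : Finset V} {E T : Finset (Finset V)}
  (h : IsClosedTriangulation P E T)
include h

lemma edges_subset {t : Finset V} (ht : t ∈ T) : {e ∈ E | e ⊆ t} = powersetCard 2 t := by
  ext e
  rw [mem_filter, mem_powersetCard]
  exact ⟨fun he => ⟨he.2, h.card_edge e he.1⟩, fun he => ⟨h.mem_edges t ht e he.1 he.2, he.1⟩⟩

/-- The number of edges of a triangle `t` with `i` vertices in `B`, in terms of the number of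
vertices of `t` in `B`. -/
lemma card_edges_filter {t : Finset V} (ht : t ∈ T) (B : Finset V) (i : ℕ) :
    #{e ∈ E | #(e ∩ B) = i ∧ e ⊆ t} =
      (if i = 0 then (3 - #(t ∩ B)).choose 2 else 0) +
      (if i = 1 then #(t ∩ B) * (3 - #(t ∩ B)) else 0) +
      (if i = 2 then (#(t ∩ B)).choose 2 else 0) := by
  have h1 : {e ∈ E | #(e ∩ B) = i ∧ e ⊆ t} = {e ∈ powersetCard 2 t | #(e ∩ B) = i} := by
    rw [← h.edges_subset ht, filter_filter]
    simp only [and_comm]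
  obtain ⟨x, y, z, hxy, hxz, hyz, rfl⟩ := card_eq_three.1 (h.card_triangle t ht)
  rw [h1, card_filter, sum_powersetCard_two_triple hxy hxz hyz]
  by_cases hx : x ∈ B <;> by_cases hy : y ∈ B <;> by_cases hz : z ∈ B <;>
    rcases i with _ | _ | _ | i <;>
    simp [hx, hy, hz, hxy, hxz, hyz, insert_inter_of_mem, insert_inter_of_notMem]

/-- Double counting of incidences: every edge lies in two triangles. -/
lemma two_mul_card_edges (p : Finset V → Prop) [DecidablePred p] :
    2 * #{e ∈ E | p e} = ∑ t ∈ T, #{e ∈ E | p e ∧ e ⊆ t} := by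
  have := sum_card_bipartiteAbove_eq_sum_card_bipartiteBelow (s := {e ∈ E | p e}) (t := T)
    (fun e t => e ⊆ t)
  simp only [bipartiteAbove, bipartiteBelow, filter_filter] at this
  rw [← this, sum_congr rfl fun e he => h.card_triangles_edge e (mem_filter.1 he).1]
  simp [mul_comm]

lemma sum_card_inter (B : Finset V) (φ : ℕ → ℕ) :
    ∑ t ∈ T, φ #(t ∩ B) = #{t ∈ T | #(t ∩ B) = 0} * φ 0 + #{t ∈ T | #(t ∩ B) = 1} * φ 1
      + #{t ∈ T | #(t ∩ B) = 2} * φ 2 + #{t ∈ T | #(t ∩ B) = 3} * φ 3 := by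
  have h1 : ∀ t ∈ T, #(t ∩ B) ∈ range 4 := fun t ht => by
    have := card_le_card (inter_subset_left (s₁ := t) (s₂ := B))
    rw [h.card_triangle t ht] at this
    simp; omega
  rw [← sum_fiberwise_of_maps_to h1]
  simp only [sum_range_succ, sum_range_zero, zero_add]
  have h2 : ∀ j, ∑ t ∈ T with #(t ∩ B) = j, φ #(t ∩ B) = #{t ∈ T | #(t ∩ B) = j} * φ j := by
    intro j
    rw [sum_congr rfl fun t ht => by rw [(mem_filter.1 ht).2], sum_const, smul_eq_mul]
  simp only [h2]

lemma two_mul_card_edges_zero (B : Finset V) :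
    2 * #{e ∈ E | #(e ∩ B) = 0} = 3 * #{t ∈ T | #(t ∩ B) = 0} + #{t ∈ T | #(t ∩ B) = 1} := by
  rw [h.two_mul_card_edges, sum_congr rfl fun t ht => h.card_edges_filter ht B 0]
  simp only [if_true, zero_ne_one, if_false, (by norm_num : (0 : ℕ) ≠ 2), add_zero]
  rw [h.sum_card_inter B fun j => (3 - j).choose 2]
  simp
  ring

lemma card_edges_one (B : Finset V) :
    #{e ∈ E | #(e ∩ B) = 1} = #{t ∈ T | #(t ∩ B) = 1} + #{t ∈ T | #(t ∩ B) = 2} := by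
  have : 2 * #{e ∈ E | #(e ∩ B) = 1} =
      2 * (#{t ∈ T | #(t ∩ B) = 1} + #{t ∈ T | #(t ∩ B) = 2}) := by
    rw [h.two_mul_card_edges, sum_congr rfl fun t ht => h.card_edges_filter ht B 1]
    simp only [if_true, one_ne_zero, if_false, (by norm_num : (1 : ℕ) ≠ 2), add_zero, zero_add]
    rw [h.sum_card_inter B fun j => j * (3 - j)]
    simp
    ring
  omega

lemma two_mul_card_edges_two (B : Finset V) :
    2 * #{e ∈ E | #(e ∩ B) = 2} = #{t ∈ T | #(t ∩ B) = 2} + 3 * #{t ∈ T | #(t ∩ B) = 3} := by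
  rw [h.two_mul_card_edges, sum_congr rfl fun t ht => h.card_edges_filter ht B 2]
  simp only [if_true, (by norm_num : (2 : ℕ) ≠ 0), (by norm_num : (2 : ℕ) ≠ 1), if_false, zero_add]
  rw [h.sum_card_inter B fun j => j.choose 2]
  simp [Nat.choose]
  ring

lemma two_mul_card_edges_eq : 2 * #E = 3 * #T := by
  have := h.two_mul_card_edges_zero ∅
  simpa using this

lemma card_edges_eq (B : Finset V) :
    #E = #{e ∈ E | #(e ∩ B) = 0} + #{e ∈ E | #(e ∩ B) = 1} + #{e ∈ E | #(e ∩ B) = 2} := by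
  have h1 : ∀ e ∈ E, #(e ∩ B) ∈ range 3 := fun e he => by
    have := card_le_card (inter_subset_left (s₁ := e) (s₂ := B))
    rw [h.card_edge e he] at this
    simp; omega
  rw [card_eq_sum_card_fiberwise h1]
  simp [sum_range_succ]

/-- For a vertex `x` outside `B`, an even number of the triangles with exactly one vertex in `B`
contain `x`: these triangles are counted by the boundary at `x` of the set of triangles disjoint
from `B`. -/
lemma even_card_triangles_one {B : Finset V} {x : V} (hx : x ∉ B) :
    Even #{t ∈ T | #(t ∩ B) = 1 ∧ x ∈ t} := by
  have key := h.two_mul_card_edges fun e => #(e ∩ B) = 0 ∧ x ∈ e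
  have h1 : ∀ t ∈ T, #{e ∈ E | (#(e ∩ B) = 0 ∧ x ∈ e) ∧ e ⊆ t} =
      2 * (if #(t ∩ B) = 0 ∧ x ∈ t then 1 else 0) + if #(t ∩ B) = 1 ∧ x ∈ t then 1 else 0 := by
    intro t ht
    have h1 : {e ∈ E | (#(e ∩ B) = 0 ∧ x ∈ e) ∧ e ⊆ t} =
        {e ∈ powersetCard 2 t | #(e ∩ B) = 0 ∧ x ∈ e} := by
      rw [← h.edges_subset ht, filter_filter]
      simp only [and_comm]
    obtain ⟨a, b, c, hab, hac, hbc, rfl⟩ := card_eq_three.1 (h.card_triangle t ht)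
    rw [h1, card_filter, sum_powersetCard_two_triple hab hac hbc]
    by_cases hxt : x ∈ ({a, b, c} : Finset V)
    · simp only [mem_insert, mem_singleton] at hxt
      rcases hxt with rfl | rfl | rfl
      · by_cases hb : b ∈ B <;> by_cases hc : c ∈ B <;>
          simp [hx, hb, hc, hab, hac, hbc]
      · by_cases hb : a ∈ B <;> by_cases hc : c ∈ B <;>
          simp [hx, hb, hc, hac, hbc, hab.symm]
      · by_cases hb : a ∈ B <;> by_cases hc : b ∈ B <;>
          simp [hx, hb, hc, hab, hac.symm, hbc.symm]
    · simp only [hxt, and_false, if_false]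
      simp only [mem_insert, mem_singleton, not_or] at hxt
      simp [hxt]
  rw [sum_congr rfl h1, sum_add_distrib, ← mul_sum, ← card_filter, ← card_filter] at key
  rw [Nat.even_iff]
  omega

lemma edge_subset_vertices {e : Finset V} (he : e ∈ E) : e ⊆ P := by
  have := h.card_triangles_edge e he
  obtain ⟨t, ht⟩ := card_pos.1 (this ▸ two_pos)
  rw [mem_filter] at ht
  exact ht.2.trans (h.triangle_subset t ht.1)

lemma card_inter_eq_two {e : Finset V} (he : e ∈ E) (B : Finset V) : #(e ∩ B) = 2 ↔ e ⊆ B := by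
  rw [← h.card_edge e he, ← inter_eq_left]
  exact ⟨fun h1 => eq_of_subset_of_card_le inter_subset_left h1.ge, fun h1 => by rw [h1]⟩

lemma card_inter_eq_three {t : Finset V} (ht : t ∈ T) (B : Finset V) :
    #(t ∩ B) = 3 ↔ t ⊆ B := by
  rw [← h.card_triangle t ht, ← inter_eq_left]
  exact ⟨fun h1 => eq_of_subset_of_card_le inter_subset_left h1.ge, fun h1 => by rw [h1]⟩

/-- The triangles inside a proper set of vertices are independent modulo `2`: a nontrivial cycle
would be closed under passing to adjacent triangles. -/
lemma cycle_eq_zero {B : Finset V} (hB : ¬ P ⊆ B) (c : Finset V → ZMod 2)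
    (hc : ∀ e ∈ E, e ⊆ B → ∑ t ∈ T with t ⊆ B ∧ e ⊆ t, c t = 0) :
    ∀ t ∈ T, t ⊆ B → c t = 0 := by
  by_contra! hcon
  obtain ⟨t₀, ht₀, ht₀B, hct₀⟩ := hcon
  have hF := h.eq_of_closed {t ∈ T | t ⊆ B ∧ c t ≠ 0} (filter_subset _ _)
    ⟨t₀, by simp [ht₀, ht₀B, hct₀]⟩ (by
      intro s hs t ht e he hes het
      rw [mem_filter] at hs ⊢
      obtain ⟨hsT, hsB, hcs⟩ := hs
      by_cases hst : t = s
      · exact hst ▸ ⟨hsT, hsB, hcs⟩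
      have h2 : {t ∈ T | e ⊆ t} = {t, s} := by
        refine (eq_of_subset_of_card_le ?_ ?_).symm
        · simp [insert_subset_iff, hsT, ht, hes, het]
        · rw [h.card_triangles_edge e he, card_pair hst]
      have h3 := hc e he (hes.trans hsB)
      rw [filter_congr fun _ _ => and_comm, ← filter_filter, h2, filter_insert, filter_singleton,
        if_pos hsB] at h3
      by_cases htB : t ⊆ B
      · rw [if_pos htB, sum_pair hst] at h3
        refine ⟨ht, htB, fun h0 => hcs ?_⟩
        rwa [h0, zero_add] at h3
      · rw [if_neg htB, sum_singleton] at h3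
        exact absurd h3 hcs)
  apply hB
  intro v hv
  obtain ⟨t, ht, hvt⟩ := h.exists_triangle v hv
  rw [← hF, mem_filter] at ht
  exact ht.2.1 hvt

/-- A connected proper set `B` of vertices spans a subcomplex of Euler characteristic at most one.
Modulo `2`, the coboundary from vertices to edges has rank at least `#B - 1` since `B` is connected,
the coboundary from edges to triangles is onto by `cycle_eq_zero`, and their composite is zero. -/
lemma card_add_card_triangles_le {B : Finset V} (hB : ¬ P ⊆ B)
    (hconn : ∀ D ⊆ B, D.Nonempty → (∀ e ∈ E, e ⊆ B → ¬ Disjoint e D → e ⊆ D) → D = B) :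
    #B + #{t ∈ T | t ⊆ B} ≤ #{e ∈ E | e ⊆ B} + 1 := by
  classical
  set T₃ := {t ∈ T | t ⊆ B} with hT₃
  set E₂ := {e ∈ E | e ⊆ B} with hE₂
  -- the two coboundary matrices
  let M : Matrix T₃ E₂ (ZMod 2) := fun t e => if e.1 ⊆ t.1 then 1 else 0
  let N : Matrix E₂ B (ZMod 2) := fun e v => if v.1 ∈ e.1 then 1 else 0
  have hMN : M * N = 0 := by
    ext t v
    rw [Matrix.mul_apply, Matrix.zero_apply]
    have ht := (mem_filter.1 t.2)
    have h1 : ∑ e : E₂, M t e * N e v =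
        ((∑ e ∈ powersetCard 2 t.1, if v.1 ∈ e then 1 else 0 : ℕ) : ZMod 2) := by
      rw [← h.edges_subset ht.1, Nat.cast_sum, sum_filter]
      have h2 := sum_coe_sort E₂ fun e : Finset V =>
        (if e ⊆ t.1 then 1 else 0) * (if v.1 ∈ e then 1 else 0 : ZMod 2)
      refine h2.trans ?_
      rw [hE₂, sum_filter]
      refine sum_congr rfl fun e _ => ?_
      by_cases het : e ⊆ t.1
      · simp [het, het.trans ht.2]
      · simp [het]
    rw [h1]
    obtain ⟨x, y, z, hxy, hxz, hyz, hxyz⟩ := card_eq_three.1 (h.card_triangle t.1 ht.1)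
    rw [hxyz, sum_powersetCard_two_triple hxy hxz hyz, ZMod.natCast_eq_zero_iff]
    by_cases hv : v.1 ∈ ({x, y, z} : Finset V)
    · simp only [mem_insert, mem_singleton] at hv
      rcases hv with hv | hv | hv <;> simp [hv, hxy, hxz, hyz, hxy.symm, hxz.symm, hyz.symm]
    · simp only [mem_insert, mem_singleton, not_or] at hv
      simp [hv]
  have hM : M.rank = #T₃ := by
    have : LinearIndependent (ZMod 2) M.row := by
      rw [Fintype.linearIndependent_iff]
      intro c hc t
      let c' : Finset V → ZMod 2 := fun t => if ht : t ∈ T₃ then c ⟨t, ht⟩ else 0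
      have hc' : ∀ t : T₃, c' t.1 = c t := fun t => by simp [c', t.2]
      have ht := (mem_filter.1 t.2)
      rw [← hc' t]
      refine h.cycle_eq_zero hB c' (fun e he heB => ?_) t.1 ht.1 ht.2
      have h1 := congrFun hc ⟨e, mem_filter.2 ⟨he, heB⟩⟩
      rw [Finset.sum_apply] at h1
      rw [← filter_filter, sum_filter, ← sum_coe_sort]
      refine Eq.trans (sum_congr rfl fun t _ => ?_) h1
      rw [hc' t]
      simp [M, Matrix.row]
    rw [this.rank_matrix, Fintype.card_coe]
  have hN : #B ≤ N.rank + 1 := by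
    have h1 := N.mulVecLin.finrank_range_add_finrank_ker
    rw [Module.finrank_fintype_fun_eq_card, Fintype.card_coe] at h1
    have h2 : Module.finrank (ZMod 2) N.mulVecLin.ker ≤ 1 := by
      -- a cocycle of degree zero takes the same value at the two ends of each edge
      have hker : N.mulVecLin.ker ≤ Submodule.span (ZMod 2) {1} := by
        intro g hg
        have hge : ∀ e ∈ E, e ⊆ B → ∀ x (hx : x ∈ B) y (hy : y ∈ B), x ≠ y → x ∈ e → y ∈ e →
            g ⟨x, hx⟩ + g ⟨y, hy⟩ = 0 := by
          intro e he heB x hx y hy hxy hxe hye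
          have h3 : {x, y} = e := eq_of_subset_of_card_le (by simp [insert_subset_iff, hxe, hye])
            (by rw [h.card_edge e he, card_pair hxy])
          have h4 := congrFun (LinearMap.mem_ker.1 hg) ⟨e, mem_filter.2 ⟨he, heB⟩⟩
          rw [Matrix.mulVecLin_apply, Matrix.mulVec, dotProduct] at h4
          rw [Finset.sum_eq_add ⟨x, hx⟩ ⟨y, hy⟩ (by simpa using hxy)] at h4
          · simpa [N, hxe, hye] using h4
          · rintro ⟨z, hz⟩ - hzn
            have : z ∉ e := by
              rw [← h3]
              simpa using hzn
            simp [N, this]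
          · simp
          · simp
        let D : Finset V := B.attach.filter (fun v => g v ≠ 0) |>.map (Function.Embedding.subtype _)
        have hmem : ∀ x (hx : x ∈ B), x ∈ D ↔ g ⟨x, hx⟩ ≠ 0 := fun x hx => by simp [D, hx]
        have hDB : D ⊆ B := fun x hx => by
          simp only [D, mem_map] at hx
          obtain ⟨a, -, rfl⟩ := hx
          exact a.2
        rcases D.eq_empty_or_nonempty with h0 | hne
        · convert Submodule.zero_mem _
          ext v
          by_contra hv
          have := (hmem v.1 v.2).2 hv
          rw [h0] at this
          simp at this
        · have hD := hconn D hDB hne (by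
            intro e he heB hed y hye
            obtain ⟨x, hxe, hxD⟩ := not_disjoint_iff.1 hed
            by_cases hxy : x = y
            · exact hxy ▸ hxD
            have h3 := hge e he heB x (heB hxe) y (heB hye) hxy hxe hye
            rw [hmem y (heB hye)]
            rw [hmem x (heB hxe)] at hxD
            intro h4
            rw [h4, add_zero] at h3
            exact hxD h3)
          rw [Submodule.mem_span_singleton]
          refine ⟨1, ?_⟩
          ext v
          have h3 := (hmem v.1 v.2).1 (by rw [hD]; exact v.2)
          rw [one_smul, Pi.one_apply]
          exact (Fin.eq_one_of_ne_zero _ h3).symm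
      refine (Submodule.finrank_mono hker).trans ?_
      simpa using finrank_span_le_card (R := ZMod 2) ({1} : Set (B → ZMod 2))
    have h3 : N.rank = Module.finrank (ZMod 2) N.mulVecLin.range := rfl
    omega
  have := Matrix.rank_add_rank_le_card_of_mul_eq_zero hMN
  rw [Fintype.card_coe] at this
  omega

/-- If at most two triangles have exactly one vertex in `B`, then at most one edge is disjoint
from `B`. This covers the sets `B` whose complement is too small for the estimate by Euler
characteristics. -/
lemma card_edges_zero_le_one {B : Finset V} (hBP : (P ∩ B).Nonempty)
    (h1 : #{t ∈ T | #(t ∩ B) = 1} ≤ 2) : #{e ∈ E | #(e ∩ B) = 0} ≤ 1 := by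
  have key := h.two_mul_card_edges_zero B
  rcases eq_empty_or_nonempty {t ∈ T | #(t ∩ B) = 0} with h0 | hne
  · rw [h0, card_empty] at key
    omega
  exfalso
  -- some edge separates a triangle disjoint from `B` from one which meets `B`
  obtain ⟨s, hs, t, ht, e, he, hes, het, htn⟩ : ∃ s ∈ {t ∈ T | #(t ∩ B) = 0}, ∃ t ∈ T, ∃ e ∈ E,
      e ⊆ s ∧ e ⊆ t ∧ t ∉ {t ∈ T | #(t ∩ B) = 0} := by
    by_contra! hcon
    have := h.eq_of_closed _ (filter_subset _ _) hne hcon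
    obtain ⟨v, hv⟩ := hBP
    obtain ⟨t, ht, hvt⟩ := h.exists_triangle v (mem_inter.1 hv).1
    rw [← this, mem_filter, card_eq_zero] at ht
    have : v ∈ t ∩ B := mem_inter.2 ⟨hvt, (mem_inter.1 hv).2⟩
    rw [ht.2] at this
    simp at this
  rw [mem_filter, card_eq_zero, ← disjoint_iff_inter_eq_empty] at hs
  simp only [mem_filter, ht, true_and] at htn
  have heB : Disjoint e B := disjoint_of_subset_left hes hs.2
  have ht1 : #(t ∩ B) = 1 := by
    have h2 : t ∩ B ⊆ t \ e := fun x hx =>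
      mem_sdiff.2 ⟨(mem_inter.1 hx).1, fun hxe => disjoint_left.1 heB hxe (mem_inter.1 hx).2⟩
    have := card_le_card h2
    rw [card_sdiff_of_subset het, h.card_triangle t ht, h.card_edge e he] at this
    omega
  -- by parity, both ends of `e` lie in two, hence in the same two triangles
  have h2 : ∀ x ∈ e, ∀ t' ∈ {t ∈ T | #(t ∩ B) = 1}, x ∈ t' := by
    intro x hx
    have hpar := h.even_card_triangles_one (disjoint_left.1 heB hx)
    have hpos : 0 < #{t ∈ T | #(t ∩ B) = 1 ∧ x ∈ t} :=
      card_pos.2 ⟨t, mem_filter.2 ⟨ht, ht1, het hx⟩⟩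
    have hsub : {t ∈ T | #(t ∩ B) = 1 ∧ x ∈ t} ⊆ {t ∈ T | #(t ∩ B) = 1} := by
      rw [← filter_filter]; exact filter_subset _ _
    have hle := card_le_card hsub
    have heq := eq_of_subset_of_card_le hsub (by obtain ⟨k, hk⟩ := hpar; omega)
    intro t' ht'
    rw [← heq, mem_filter] at ht'
    exact ht'.2.2
  obtain ⟨x, hx⟩ : e.Nonempty := card_pos.1 (by rw [h.card_edge e he]; norm_num)
  have h3 : #{t ∈ T | #(t ∩ B) = 1} = 2 := by
    obtain ⟨k, hk⟩ := h.even_card_triangles_one (disjoint_left.1 heB hx)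
    have h5 : {t ∈ T | #(t ∩ B) = 1 ∧ x ∈ t} = {t ∈ T | #(t ∩ B) = 1} := by
      refine filter_congr fun t' ht' => ⟨fun h => h.1, fun h4 => ⟨h4, h2 x hx t' ?_⟩⟩
      exact mem_filter.2 ⟨ht', h4⟩
    have hpos : 0 < #{t ∈ T | #(t ∩ B) = 1} := card_pos.2 ⟨t, mem_filter.2 ⟨ht, ht1⟩⟩
    rw [h5] at hk
    omega
  have h4 : insert s {t ∈ T | #(t ∩ B) = 1} ⊆ {t ∈ T | e ⊆ t} := by
    rw [insert_subset_iff]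
    refine ⟨mem_filter.2 ⟨hs.1, hes⟩, fun t' ht' => mem_filter.2 ⟨(mem_filter.1 ht').1, ?_⟩⟩
    exact fun x hx => h2 x hx t' ht'
  have h5 := card_le_card h4
  rw [card_insert_of_notMem (by simp [disjoint_iff_inter_eq_empty.1 hs.2]), h3,
    h.card_triangles_edge e he] at h5
  omega

/-- A set `B` of vertices meets at least its proportional share of the edges, if `χ ≥ 0`. It
suffices to treat connected sets `B`, as the number of edges met is additive. -/
lemma card_edges_mul_card_le (hχ : #E ≤ #P + #T) {B : Finset V} (hB : B ⊆ P) :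
    #E * #B ≤ #{e ∈ E | ¬ Disjoint e B} * #P := by
  induction B using Finset.strongInduction with
  | H B ih =>
  rcases eq_or_ne B ∅ with rfl | hne
  · simp
  rcases eq_or_ne B P with rfl | hBP
  · refine Nat.mul_le_mul_right _ (card_le_card fun e he => mem_filter.2 ⟨he, fun hd => ?_⟩)
    have h1 := h.edge_subset_vertices he
    rw [disjoint_of_subset_iff_left_eq_empty h1] at hd
    have := h.card_edge e he
    rw [hd] at this; simp at this
  have hPB : ¬ P ⊆ B := fun hPB => hBP (hB.antisymm hPB)
  by_cases hconn : ∀ D ⊆ B, D.Nonempty → (∀ e ∈ E, e ⊆ B → ¬ Disjoint e D → e ⊆ D) → D = B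
  swap
  · push Not at hconn
    obtain ⟨D, hD, hDne, hDE, hDB⟩ := hconn
    have ih1 := ih D (hD.ssubset_of_ne hDB) (hD.trans hB)
    have ih2 := ih (B \ D) (sdiff_ssubset hD hDne) (sdiff_subset.trans hB)
    have h1 : {e ∈ E | ¬ Disjoint e B} =
        {e ∈ E | ¬ Disjoint e D} ∪ {e ∈ E | ¬ Disjoint e (B \ D)} := by
      rw [← filter_or]
      refine filter_congr fun e _ => ?_
      rw [← not_and_or, ← disjoint_union_right, union_sdiff_of_subset hD]
    have h2 : Disjoint {e ∈ E | ¬ Disjoint e D} {e ∈ E | ¬ Disjoint e (B \ D)} := by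
      rw [disjoint_filter]
      intro e he h3 h4
      have h5 : e ⊆ B := by
        obtain ⟨x, hxe, hxD⟩ := not_disjoint_iff.1 h3
        obtain ⟨y, hye, hyD⟩ := not_disjoint_iff.1 h4
        rw [mem_sdiff] at hyD
        have : {x, y} = e := eq_of_subset_of_card_le (by simp [insert_subset_iff, hxe, hye]) (by
          rw [h.card_edge e he, card_pair]
          rintro rfl
          exact hyD.2 hxD)
        rw [← this]
        simp [insert_subset_iff, hyD.1, hD hxD]
      exact h4 (disjoint_of_subset_left (hDE e he h5 h3) disjoint_sdiff)
    rw [h1, card_union_of_disjoint h2]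
    have h3 := card_sdiff_add_card_eq_card hD
    nlinarith
  have hchi := h.card_add_card_triangles_le hPB hconn
  rw [← filter_congr fun e he => h.card_inter_eq_two he B,
    ← filter_congr fun t ht => h.card_inter_eq_three ht B] at hchi
  have e1 := h.card_edges_one B
  have e2 := h.two_mul_card_edges_two B
  have eE := h.card_edges_eq B
  have eT := h.two_mul_card_edges_eq
  have e0 : #{e ∈ E | ¬ Disjoint e B} + #{e ∈ E | #(e ∩ B) = 0} = #E := by
    simp only [card_eq_zero, ← disjoint_iff_inter_eq_empty]
    rw [add_comm, card_filter_add_card_filter_not]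
  rcases le_or_gt #{t ∈ T | #(t ∩ B) = 1} 2 with ht1 | ht1
  -- at most one edge misses `B`
  · have he0 := h.card_edges_zero_le_one (by
      rw [inter_eq_right.2 hB]; exact nonempty_iff_ne_empty.2 hne) ht1
    have hlt : #B < #P := card_lt_card (hB.ssubset_of_ne hBP)
    rcases Nat.le_one_iff_eq_zero_or_eq_one.1 he0 with he0 | he0
    · rw [he0, add_zero] at e0
      rw [e0]
      exact Nat.mul_le_mul_left _ hlt.le
    · rw [he0] at e0
      obtain ⟨e, he⟩ := card_pos.1 (he0 ▸ one_pos)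
      rw [mem_filter, card_eq_zero, ← disjoint_iff_inter_eq_empty] at he
      have hle : #B + 2 ≤ #P := by
        rw [← h.card_edge e he.1, ← card_union_of_disjoint he.2.symm]
        exact card_le_card (union_subset hB (h.edge_subset_vertices he.1))
      have hP2 : #P ≤ #E * 2 := by
        refine (card_le_card (t := E.biUnion id) fun v hv => ?_).trans
          (card_biUnion_le_card_mul _ _ _ fun e he => (h.card_edge e he).le)
        obtain ⟨t, ht, hvt⟩ := h.exists_triangle v hv
        obtain ⟨s, hvs, hst, hs⟩ := exists_subsuperset_card_eq (n := 2)
          (singleton_subset_iff.2 hvt) (by simp) (by rw [h.card_triangle t ht]; norm_num)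
        exact mem_biUnion.2 ⟨s, h.mem_edges t ht s hst hs, singleton_subset_iff.1 hvs⟩
      obtain ⟨k, hk⟩ := Nat.exists_eq_add_of_le hle
      rw [← e0] at hP2 ⊢
      nlinarith
  -- the number of edges met is `3 * #B + t₁ - 3 * χ_B`, where `t₁ ≥ 3` is the number of triangles
  -- with exactly one vertex in `B` and `χ_B ≤ 1`; on the other hand `#E = 3 * #P - 3 * χ`
  · have h3 : 3 * #B ≤ #{e ∈ E | ¬ Disjoint e B} := by omega
    have h4 : #E ≤ 3 * #P := by omega
    calc #E * #B ≤ 3 * #P * #B := Nat.mul_le_mul_right _ h4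
      _ = 3 * #B * #P := by ring
      _ ≤ _ := Nat.mul_le_mul_right _ h3

end IsClosedTriangulation

end Combinatorics

/-! ### Logarithms of functions without zeros -/

section Topology

open Topology

/-- Every nowhere vanishing continuous complex function on `A` has a continuous logarithm. (For
nice spaces `A` this says that the first integral cohomology of `A` vanishes.) -/
def HasLogs {X : Type*} [TopologicalSpace X] (A : Set X) : Prop :=
  ∀ f : X → ℂ, ContinuousOn f A → (∀ x ∈ A, f x ≠ 0) →
    ∃ h : X → ℂ, ContinuousOn h A ∧ ∀ x ∈ A, Complex.exp (h x) = f x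

lemma eq_of_exp_eq_of_isPreconnected {X : Type*} [TopologicalSpace X] {s : Set X}
    (hs : IsPreconnected s) {g : X → ℂ} (hg : ContinuousOn g s) {c : ℂ}
    (hc : ∀ x ∈ s, Complex.exp (g x) = c) {a b : X} (ha : a ∈ s) (hb : b ∈ s) : g a = g b :=
  Complex.isCoveringMap_exp.constOn_of_comp hs hg
    (fun x hx y hy => Subtype.ext ((hc x hx).trans (hc y hy).symm)) ha hb

lemma HasLogs.of_retract {X Y : Type*} [TopologicalSpace X] [TopologicalSpace Y] {A : Set X}
    {B : Set Y} (hA : HasLogs A) {j : X → Y} {k : Y → X} (hk : ContinuousOn k B)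
    (hkA : Set.MapsTo k B A) (hj : ContinuousOn j A) (hjB : Set.MapsTo j A B)
    (hjk : ∀ b ∈ B, j (k b) = b) : HasLogs B := by
  intro f hf hf0
  obtain ⟨h, hh, hh'⟩ := hA (f ∘ j) (hf.comp hj hjB) fun x hx => hf0 _ (hjB hx)
  refine ⟨h ∘ k, hh.comp hk hkA, fun b hb => ?_⟩
  rw [Function.comp_apply, hh' _ (hkA hb), Function.comp_apply, hjk b hb]

/-- Mayer–Vietoris: logarithms on two open pieces differ by a constant on a connected overlap. -/
lemma HasLogs.of_cover {X : Type*} [TopologicalSpace X] {S U W : Set X} (hU : IsOpen U)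
    (hW : IsOpen W) (hSU : HasLogs (S ∩ U)) (hSW : HasLogs (S ∩ W)) (hcov : S ⊆ U ∪ W)
    (hconn : IsPreconnected (S ∩ (U ∩ W))) : HasLogs S := by
  classical
  intro f hf hf0
  obtain ⟨h₁, hc₁, he₁⟩ := hSU f (hf.mono Set.inter_subset_left) fun x hx => hf0 x hx.1
  obtain ⟨h₂, hc₂, he₂⟩ := hSW f (hf.mono Set.inter_subset_left) fun x hx => hf0 x hx.1
  obtain ⟨c, hc, hcd⟩ : ∃ c : ℂ, Complex.exp c = 1 ∧ ∀ x ∈ S ∩ (U ∩ W), h₁ x = h₂ x + c := by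
    have he : ∀ x ∈ S ∩ (U ∩ W), Complex.exp (h₁ x - h₂ x) = 1 := fun x hx => by
      rw [Complex.exp_sub, he₁ x ⟨hx.1, hx.2.1⟩, he₂ x ⟨hx.1, hx.2.2⟩, div_self (hf0 x hx.1)]
    rcases (S ∩ (U ∩ W)).eq_empty_or_nonempty with h0 | ⟨a, ha⟩
    · exact ⟨0, Complex.exp_zero, by simp [h0]⟩
    · refine ⟨h₁ a - h₂ a, he a ha, fun x hx => ?_⟩
      have hcont : ContinuousOn (fun x => h₁ x - h₂ x) (S ∩ (U ∩ W)) :=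
        (hc₁.mono fun x hx => ⟨hx.1, hx.2.1⟩).sub (hc₂.mono fun x hx => ⟨hx.1, hx.2.2⟩)
      have := eq_of_exp_eq_of_isPreconnected hconn hcont he ha hx
      rw [this]; ring
  have h₂' : ∀ x ∈ S ∩ W, (if x ∈ U then h₁ x else h₂ x + c) = h₂ x + c := fun x hx => by
    split_ifs with hxU
    · exact hcd x ⟨hx.1, hxU, hx.2⟩
    · rfl
  refine ⟨fun x => if x ∈ U then h₁ x else h₂ x + c, fun x hx => ?_, fun x hx => ?_⟩
  · rcases hcov hx with hxU | hxW
    · rw [← continuousWithinAt_inter (hU.mem_nhds hxU)]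
      exact (hc₁ x ⟨hx, hxU⟩).congr (fun y hy => if_pos hy.2) (if_pos hxU)
    · rw [← continuousWithinAt_inter (hW.mem_nhds hxW)]
      exact ((hc₂ x ⟨hx, hxW⟩).add continuousWithinAt_const).congr h₂' (h₂' x ⟨hx, hxW⟩)
  · rcases hcov hx with hxU | hxW
    · simp only [if_pos hxU, he₁ x ⟨hx, hxU⟩]
    · simp only [h₂' x ⟨hx, hxW⟩, Complex.exp_add, hc, he₂ x ⟨hx, hxW⟩, mul_one]

open unitInterval in
/-- The straight-line homotopy to the centre lifts through the covering map `exp`. -/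
lemma StarConvex.hasLogs {E : Type*} [NormedAddCommGroup E] [NormedSpace ℝ E] {A : Set E} {q : E}
    (hA : StarConvex ℝ q A) : HasLogs A := by
  classical
  intro f hf hf0
  rcases A.eq_empty_or_nonempty with rfl | hne
  · exact ⟨0, continuousOn_empty _, by simp⟩
  have hqA : q ∈ A := hA.mem hne
  have hmem : ∀ (t : I) (a : A), (1 - (t : ℝ)) • q + (t : ℝ) • (a : E) ∈ A := fun t a =>
    hA a.2 (sub_nonneg.2 t.2.2) t.2.1 (by ring)
  let H : C(I × A, {z : ℂ // z ≠ 0}) :=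
    ⟨fun p => ⟨f ((1 - (p.1 : ℝ)) • q + (p.1 : ℝ) • (p.2 : E)), hf0 _ (hmem p.1 p.2)⟩, by
      refine Continuous.subtype_mk (hf.comp_continuous
        (f := fun p : I × A => (1 - (p.1 : ℝ)) • q + (p.1 : ℝ) • (p.2 : E))
        (by fun_prop) fun p => hmem p.1 p.2) _⟩
  have H0 : ∀ a, H (0, a) = ⟨Complex.exp (Complex.log (f q)), Complex.exp_ne_zero _⟩ := fun a => by
    ext
    simp [H, Complex.exp_log (hf0 q hqA)]
  let L := Complex.isCoveringMap_exp.liftHomotopy H (.const A (Complex.log (f q))) H0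
  have hL : ∀ a : A, Complex.exp (L (1, a)) = f a := fun a => by
    have := congrArg Subtype.val
      (congrFun (Complex.isCoveringMap_exp.liftHomotopy_lifts H (.const A _) H0) (1, a))
    refine Eq.trans this ?_
    simp [H]
  refine ⟨fun x => if hx : x ∈ A then L (1, ⟨x, hx⟩) else 0, ?_, fun x hx => ?_⟩
  · rw [continuousOn_iff_continuous_domRestrict]
    have : A.domRestrict (fun x => if hx : x ∈ A then L (1, ⟨x, hx⟩) else 0) =
        fun a => L (1, a) := by
      ext a
      simp
    rw [this]
    fun_prop
  · simp only [dif_pos hx]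
    exact hL ⟨x, hx⟩

/-- In dimension at least three the complement of the origin is covered by the complements of two
opposite closed rays, whose overlap, the complement of a line, is connected. -/
lemma hasLogs_compl_zero {E : Type*} [NormedAddCommGroup E] [NormedSpace ℝ E]
    [FiniteDimensional ℝ E] (hE : 3 ≤ Module.finrank ℝ E) : HasLogs ({0}ᶜ : Set E) := by
  have : Nontrivial E := Module.nontrivial_of_finrank_pos (R := ℝ) (by omega)
  obtain ⟨w, hw⟩ := exists_ne (0 : E)
  -- the complement of a closed ray is star-shaped about the points of the opposite ray
  have hray : ∀ w : E, w ≠ 0 → IsOpen ((fun s : ℝ => s • w) '' Set.Ici 0)ᶜ ∧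
      HasLogs (({0}ᶜ : Set E) ∩ ((fun s : ℝ => s • w) '' Set.Ici 0)ᶜ) := by
    intro w hw
    refine ⟨((isClosedEmbedding_smul_left hw).isClosedMap _ isClosed_Ici).isOpen_compl, ?_⟩
    rw [Set.inter_eq_right.2 (by
      rw [Set.compl_subset_compl, Set.singleton_subset_iff]
      exact ⟨0, Set.self_mem_Ici, zero_smul _ _⟩)]
    refine StarConvex.hasLogs (q := -w) ?_
    rintro y hy a b ha hb hab ⟨s, hs, hsy⟩
    rw [Set.mem_Ici] at hs
    simp only at hsy
    rcases hb.eq_or_lt with rfl | hb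
    · rw [add_zero] at hab
      subst hab
      have : (s + 1) • w = 0 := by
        rw [add_smul, hsy]; simp
      rcases smul_eq_zero.1 this with h | h
      · linarith
      · exact hw h
    · refine hy ⟨(s + a) / b, by simp only [Set.mem_Ici]; positivity, ?_⟩
      have : (s + a) • w = b • y := by
        rw [add_smul, hsy]; simp
      simp only
      rw [div_eq_inv_mul, mul_smul, this, smul_smul, inv_mul_cancel₀ hb.ne', one_smul]
  have hspan : ((fun s : ℝ => s • w) '' Set.Ici 0)ᶜ ∩ ((fun s : ℝ => s • -w) '' Set.Ici 0)ᶜ =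
      ((Submodule.span ℝ {w} : Submodule ℝ E) : Set E)ᶜ := by
    rw [← Set.compl_union]
    congr 1
    ext x
    simp only [Set.mem_union, Set.mem_image, Set.mem_Ici, SetLike.mem_coe,
      Submodule.mem_span_singleton]
    constructor
    · rintro (⟨s, -, rfl⟩ | ⟨s, -, rfl⟩)
      · exact ⟨s, rfl⟩
      · exact ⟨-s, by simp⟩
    · rintro ⟨s, rfl⟩
      rcases le_total 0 s with hs | hs
      · exact Or.inl ⟨s, hs, rfl⟩
      · exact Or.inr ⟨-s, by linarith, by simp⟩
  refine HasLogs.of_cover (hray w hw).1 (hray (-w) (neg_ne_zero.2 hw)).1 (hray w hw).2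
    (hray (-w) (neg_ne_zero.2 hw)).2 ?_ ?_
  · intro x hx
    rw [Set.mem_union]
    by_contra! hcon
    simp only [Set.mem_compl_iff, not_not] at hcon
    obtain ⟨⟨s, hs, rfl⟩, t, ht, hst⟩ := hcon
    simp only [smul_neg, Set.mem_Ici] at hst hs ht
    have : (s + t) • w = 0 := by
      rw [add_smul, ← hst]; simp
    have hst0 := (smul_eq_zero.1 this).resolve_right hw
    have : s = 0 := by linarith
    exact hx (by simp [this])
  · rw [hspan, Set.inter_eq_right.2 (by
      rw [Set.compl_subset_compl, Set.singleton_subset_iff]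
      exact Submodule.zero_mem _)]
    refine (isConnected_compl_of_one_lt_codim (E := Submodule.span ℝ {w}) ?_).isPreconnected
    have h1 := Submodule.finrank_quotient_add_finrank (Submodule.span ℝ {w})
    rw [finrank_span_singleton hw] at h1
    exact_mod_cast Module.lt_rank_of_lt_finrank (R := ℝ) (n := 1)
      (M := E ⧸ Submodule.span ℝ {w}) (by omega)

/-- The winding number of the circle is not zero: `z ^ n` has no logarithm on it. -/
lemma eq_zero_of_zpow_eq_exp {n : ℤ} {H : ℂ → ℂ} (hH : ContinuousOn H (Metric.sphere 0 1))
    (h : ∀ z ∈ Metric.sphere (0 : ℂ) 1, z ^ n = Complex.exp (H z)) : n = 0 := by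
  have hmem : ∀ t : ℝ, Complex.exp (t * Complex.I) ∈ Metric.sphere (0 : ℂ) 1 := fun t => by
    simp [Complex.norm_exp_ofReal_mul_I]
  have key := eq_of_exp_eq_of_isPreconnected (s := Set.univ)
    (g := fun t : ℝ => H (Complex.exp (t * Complex.I)) - n * (t * Complex.I)) (c := 1)
    isPreconnected_univ (by
      refine Continuous.continuousOn ?_
      refine Continuous.sub (hH.comp_continuous (by fun_prop) hmem) (by fun_prop))
    (fun t _ => by
      rw [Complex.exp_sub, ← h _ (hmem t), Complex.exp_int_mul, div_self]
      exact zpow_ne_zero _ (Complex.exp_ne_zero _)) (Set.mem_univ 0) (Set.mem_univ (2 * Real.pi))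
  simp only [Complex.ofReal_zero, zero_mul, Complex.exp_zero, mul_zero, sub_zero,
    Complex.ofReal_mul, Complex.ofReal_ofNat, Complex.exp_two_pi_mul_I] at key
  have h2 : (n : ℂ) * (2 * Real.pi * Complex.I) = 0 := by linear_combination key
  simpa [Complex.two_pi_I_ne_zero] using h2

/-- A nowhere vanishing function on a punctured disc has a logarithm up to a power of `z`. -/
lemma exists_eq_zpow_mul_exp {r : ℝ} {f : ℂ → ℂ}
    (hf : ContinuousOn f (Metric.ball 0 r \ {0}))
    (hf0 : ∀ z ∈ Metric.ball (0 : ℂ) r \ {0}, f z ≠ 0) :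
    ∃ (n : ℤ) (h : ℂ → ℂ), ContinuousOn h (Metric.ball 0 r \ {0}) ∧
      ∀ z ∈ Metric.ball (0 : ℂ) r \ {0}, f z = z ^ n * Complex.exp (h z) := by
  -- pull `f` back along `exp` to a half-plane, where it has a logarithm `h`
  set L : Set ℂ := {w | Complex.exp w ∈ Metric.ball (0 : ℂ) r} with hL
  have hLexp : Set.MapsTo Complex.exp L (Metric.ball 0 r \ {0}) := fun w hw =>
    ⟨hw, Complex.exp_ne_zero _⟩
  have hLconv : Convex ℝ L := by
    have : L = {w | Real.exp w.re < r} := by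
      ext w; simp [hL, Complex.norm_exp]
    rw [this]
    rcases le_or_gt r 0 with hr | hr
    · convert convex_empty
      ext w
      simp [(hr.trans (Real.exp_pos _).le)]
    · simp_rw [← Real.lt_log_iff_exp_lt hr]
      exact convex_halfSpace_re_lt _
  have hLadd : ∀ w ∈ L, ∀ k : ℤ, w + k * (2 * Real.pi * Complex.I) ∈ L := fun w hw k => by
    rw [hL, Set.mem_ofPred_eq, Complex.exp_periodic.int_mul]
    exact hw
  have hlogs : HasLogs L := by
    rcases L.eq_empty_or_nonempty with h | ⟨q, hq⟩
    · exact StarConvex.hasLogs (q := 0) (h ▸ starConvex_empty 0)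
    · exact (hLconv.starConvex hq).hasLogs
  obtain ⟨h, hh, he⟩ := hlogs (f ∘ Complex.exp)
    (hf.comp Complex.continuous_exp.continuousOn hLexp) fun w hw => hf0 _ (hLexp hw)
  -- `h` changes by a constant multiple of `2πi` along the period of `exp`
  obtain ⟨n, hn⟩ : ∃ n : ℤ, ∀ w ∈ L,
      h (w + 2 * Real.pi * Complex.I) = h w + n * (2 * Real.pi * Complex.I) := by
    have hL1 : ∀ w ∈ L, w + 2 * Real.pi * Complex.I ∈ L := fun w hw => by
      simpa using hLadd w hw 1
    have h1 : ∀ w ∈ L, Complex.exp (h (w + 2 * Real.pi * Complex.I) - h w) = 1 := fun w hw => by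
      rw [Complex.exp_sub, he _ (hL1 w hw), he _ hw, Function.comp_apply, Function.comp_apply,
        Complex.exp_periodic w, div_self (hf0 _ (hLexp hw))]
    rcases L.eq_empty_or_nonempty with h0 | ⟨q, hq⟩
    · exact ⟨0, by simp [h0]⟩
    · obtain ⟨n, hn⟩ := Complex.exp_eq_one_iff.1 (h1 q hq)
      refine ⟨n, fun w hw => ?_⟩
      have hcont : ContinuousOn (fun w => h (w + 2 * Real.pi * Complex.I) - h w) L :=
        (hh.comp (by fun_prop) hL1).sub hh
      have := eq_of_exp_eq_of_isPreconnected hLconv.isPreconnected hcont h1 hw hq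
      rw [← hn, ← this]; ring
  -- `h w - n w` is periodic, so it descends along `exp`
  have hper : ∀ w ∈ L, ∀ w' ∈ L, Complex.exp w = Complex.exp w' → h w - n * w = h w' - n * w' := by
    have hnat : ∀ k : ℕ, ∀ w ∈ L, h (w + k * (2 * Real.pi * Complex.I)) =
        h w + k * (n * (2 * Real.pi * Complex.I)) := by
      intro k w hw
      induction k with
      | zero => simp
      | succ k ih =>
        have := hn _ (by simpa using hLadd w hw k)
        rw [ih] at this
        push_cast
        rw [add_mul, one_mul, ← add_assoc, this]
        ring
    have hle : ∀ (k : ℕ), ∀ w ∈ L, ∀ w' ∈ L, w = w' + k * (2 * Real.pi * Complex.I) →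
        h w - n * w = h w' - n * w' := by
      rintro k w hw w' hw' rfl
      rw [hnat k w' hw']; ring
    intro w hw w' hw' hww
    obtain ⟨k, hk⟩ := Complex.exp_eq_exp_iff_exists_int.1 hww
    obtain ⟨m, rfl | rfl⟩ := k.eq_nat_or_neg
    · exact hle m w hw w' hw' (by simpa using hk)
    · exact (hle m w' hw' w hw (by rw [hk]; push_cast; ring)).symm
  have hlog : ∀ z ∈ Metric.ball (0 : ℂ) r \ {0}, Complex.log z ∈ L := fun z hz => by
    rw [hL, Set.mem_ofPred_eq, Complex.exp_log hz.2]
    exact hz.1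
  have hlog' : ∀ z ∈ Metric.ball (0 : ℂ) r \ {0},
      Complex.exp (Complex.log (-z) + Real.pi * Complex.I) = z := fun z hz => by
    rw [Complex.exp_add, Complex.exp_pi_mul_I, Complex.exp_log (neg_ne_zero.2 hz.2)]
    ring
  have hlogL' : ∀ z ∈ Metric.ball (0 : ℂ) r \ {0},
      Complex.log (-z) + Real.pi * Complex.I ∈ L := fun z hz => by
    rw [hL, Set.mem_ofPred_eq, hlog' z hz]
    exact hz.1
  have hcn : ContinuousOn (fun w => h w - n * w) L := hh.sub (by fun_prop)
  refine ⟨n, fun z => h (Complex.log z) - n * Complex.log z, fun z hz => ?_, fun z hz => ?_⟩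
  · by_cases hs : z ∈ Complex.slitPlane
    · exact ContinuousWithinAt.comp (t := L) (hcn _ (hlog z hz))
        (continuousAt_clog hs).continuousWithinAt hlog
    -- across the branch cut, use the branch `log (-z) + πi` instead
    · have hs' : -z ∈ Complex.slitPlane := by
        rw [Complex.mem_slitPlane_iff] at hs ⊢
        push Not at hs
        left
        have : z.re ≠ 0 := fun h0 => hz.2 (Complex.ext h0 hs.2)
        simpa using lt_of_le_of_ne hs.1 this
      have h1 : ∀ z ∈ Metric.ball (0 : ℂ) r \ {0}, h (Complex.log z) - n * Complex.log z =
          (fun w => h w - n * w) (Complex.log (-z) + Real.pi * Complex.I) := fun z hz =>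
        hper _ (hlog z hz) _ (hlogL' z hz) (by rw [hlog' z hz, Complex.exp_log hz.2])
      refine ContinuousWithinAt.congr ?_ h1 (h1 z hz)
      refine ContinuousWithinAt.comp (t := L) (f := fun z => Complex.log (-z) + Real.pi * Complex.I)
        (hcn _ (hlogL' z hz)) ?_ hlogL'
      exact (((continuousAt_clog hs').comp continuousAt_neg).add
        continuousAt_const).continuousWithinAt
  · rw [Complex.exp_sub, he _ (hlog z hz), Complex.exp_int_mul, Function.comp_apply,
      Complex.exp_log hz.2, mul_div_cancel₀]
    exact zpow_ne_zero _ hz.2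

open Metric

/-! ### Local obstructions to being a surface -/

/-- `φ` and `ψ` are inverse homeomorphisms between a neighbourhood of `x₀` in `R` and the disc of
radius `r` about `0` in the complex plane. Both are total functions, of which only the values on
these two sets matter. -/
structure IsPlanarChart {E : Type*} [TopologicalSpace E] (R : Set E) (x₀ : E) (φ : E → ℂ)
    (ψ : ℂ → E) (r : ℝ) : Prop where
  pos : 0 < r
  continuousOn_symm : ContinuousOn ψ (ball 0 r)
  mapsTo : Set.MapsTo ψ (ball 0 r) R
  map_zero : ψ 0 = x₀
  left_inv : ∀ z ∈ ball (0 : ℂ) r, φ (ψ z) = z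
  continuousOn : ContinuousOn φ (ψ '' ball 0 r)
  image_mem : ψ '' ball 0 r ∈ 𝓝[R] x₀

/-- The subspace `R` is a topological surface near its point `x₀`. -/
def PlanarAt {E : Type*} [TopologicalSpace E] (R : Set E) (x₀ : E) : Prop :=
  ∃ φ ψ r, IsPlanarChart R x₀ φ ψ r

section

variable {E : Type*} [TopologicalSpace E] {R : Set E} {x₀ : E} {φ : E → ℂ} {ψ : ℂ → E} {r : ℝ}

lemma IsPlanarChart.exists_subset (c : IsPlanarChart R x₀ φ ψ r) {W : Set E} (hW : W ∈ 𝓝[R] x₀) :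
    ∃ r', IsPlanarChart R x₀ φ ψ r' ∧ ψ '' ball 0 r' ⊆ W := by
  have h0 : (0 : ℂ) ∈ ball (0 : ℂ) r := mem_ball_self c.pos
  have hψ : Filter.Tendsto ψ (𝓝 0) (𝓝[R] x₀) := by
    rw [tendsto_nhdsWithin_iff]
    refine ⟨?_, ?_⟩
    · have := (c.continuousOn_symm 0 h0).continuousAt (isOpen_ball.mem_nhds h0)
      rw [ContinuousAt, c.map_zero] at this
      exact this
    · filter_upwards [isOpen_ball.mem_nhds h0] with z hz using c.mapsTo hz
  obtain ⟨ε, hε, hεW⟩ := Metric.mem_nhds_iff.1 (hψ hW)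
  have hsub : ball (0 : ℂ) (min ε r) ⊆ ball 0 r := ball_subset_ball (min_le_right _ _)
  refine ⟨min ε r, ⟨lt_min hε c.pos, c.continuousOn_symm.mono hsub, c.mapsTo.mono_left hsub,
    c.map_zero, fun z hz => c.left_inv z (hsub hz), c.continuousOn.mono (Set.image_mono hsub), ?_⟩,
    ?_⟩
  · have h1 := c.continuousOn x₀ ⟨0, h0, c.map_zero⟩
    have h2 : φ x₀ = 0 := by rw [← c.map_zero, c.left_inv 0 h0]
    have h3 : φ ⁻¹' ball 0 (min ε r) ∈ 𝓝[ψ '' ball 0 r] x₀ :=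
      h1 (by rw [h2]; exact isOpen_ball.mem_nhds (mem_ball_self (lt_min hε c.pos)))
    filter_upwards [c.image_mem, nhdsWithin_le_of_mem c.image_mem h3] with y hy hy'
    obtain ⟨z, hz, rfl⟩ := hy
    refine ⟨z, ?_, rfl⟩
    rwa [Set.mem_preimage, c.left_inv z hz] at hy'
  · rintro _ ⟨z, hz, rfl⟩
    exact hεW (ball_subset_ball (min_le_left _ _) hz)

lemma IsPlanarChart.mapsTo_punctured (c : IsPlanarChart R x₀ φ ψ r) :
    Set.MapsTo φ (ψ '' ball 0 r \ {x₀}) (ball 0 r \ {0}) := by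
  rintro _ ⟨⟨z, hz, rfl⟩, hne⟩
  rw [c.left_inv z hz]
  refine ⟨hz, fun h0 => hne ?_⟩
  rw [Set.mem_singleton_iff] at h0 ⊢
  rw [h0, c.map_zero]

lemma IsPlanarChart.right_inv (c : IsPlanarChart R x₀ φ ψ r) {y : E} (hy : y ∈ ψ '' ball 0 r) :
    ψ (φ y) = y := by
  obtain ⟨z, hz, rfl⟩ := hy
  rw [c.left_inv z hz]

/-- A point of a surface has no small neighbourhood which is cohomologically trivial when
punctured: the coordinate function of a chart has no logarithm. -/
lemma not_planarAt_of_hasLogs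
    (h : ∀ W ∈ 𝓝[R] x₀, ∃ U ∈ 𝓝[R] x₀, U ⊆ W ∧ HasLogs (U \ {x₀})) : ¬ PlanarAt R x₀ := by
  rintro ⟨φ, ψ, r, c⟩
  obtain ⟨U, hU, hUW, hlog⟩ := h _ c.image_mem
  have hsub : U \ {x₀} ⊆ ψ '' ball 0 r \ {x₀} := Set.sdiff_subset_sdiff_left hUW
  obtain ⟨l, hl, he⟩ := hlog φ (c.continuousOn.mono (hsub.trans Set.sdiff_subset))
    fun y hy => (c.mapsTo_punctured (hsub hy)).2
  obtain ⟨ρ, c', hρ⟩ := c.exists_subset hU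
  have hρ0 := c'.pos
  have hmem : ∀ z ∈ sphere (0 : ℂ) 1, ((ρ / 2 : ℝ) : ℂ) * z ∈ ball (0 : ℂ) ρ := fun z hz => by
    rw [mem_sphere_zero_iff_norm] at hz
    rw [mem_ball_zero_iff, norm_mul, hz, Complex.norm_real, Real.norm_of_nonneg (by positivity)]
    linarith
  have hε : ((ρ / 2 : ℝ) : ℂ) ≠ 0 := Complex.ofReal_ne_zero.2 (by positivity)
  have hmem' : ∀ z ∈ sphere (0 : ℂ) 1, ψ ((ρ / 2 : ℝ) * z) ∈ U \ {x₀} := fun z hz => by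
    refine ⟨hρ ⟨_, hmem z hz, rfl⟩, fun h0 => ?_⟩
    rw [Set.mem_singleton_iff, ← c'.map_zero] at h0
    have h1 := congrArg φ h0
    rw [c'.left_inv _ (hmem z hz), c'.left_inv 0 (mem_ball_self hρ0)] at h1
    have hz0 := (mul_eq_zero.1 h1).resolve_left hε
    simp [hz0] at hz
  refine one_ne_zero (eq_zero_of_zpow_eq_exp (n := 1)
    (H := fun z => l (ψ ((ρ / 2 : ℝ) * z)) - Complex.log (ρ / 2 : ℝ)) ?_ fun z hz => ?_)
  · refine ContinuousOn.sub (hl.comp (c'.continuousOn_symm.comp (by fun_prop) hmem) hmem') ?_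
    exact continuousOn_const
  · rw [zpow_one, Complex.exp_sub, he _ (hmem' z hz), c'.left_inv _ (hmem z hz),
      Complex.exp_log hε, mul_div_cancel_left₀ _ hε]

/-- At a point of a surface the first cohomology is locally of rank one. Two functions `f`, `g` and
two arbitrarily small loops around `x₀` show that the rank is at least two if `f` winds once and `g`
does not wind along the first loop, while `g` winds once along the second. -/
lemma not_planarAt_of_two_loops {f g : E → ℂ} (hf : Continuous f) (hg : Continuous g)
    {W : Set E} (hW : W ∈ 𝓝[R] x₀) (hf0 : ∀ y ∈ W \ {x₀}, f y ≠ 0) (hg0 : ∀ y ∈ W \ {x₀}, g y ≠ 0)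
    (ha : ∀ U ∈ 𝓝[R] x₀, ∃ ε : ℝ, 0 < ε ∧ ∃ a : ℂ → E, Continuous a ∧
      ∀ z ∈ sphere (0 : ℂ) 1, a z ∈ U \ {x₀} ∧ f (a z) = ε * z ∧
        g (a z) = ε * (z.re + |z.im| * Complex.I))
    (hb : ∀ U ∈ 𝓝[R] x₀, ∃ ε : ℝ, 0 < ε ∧ ∃ b : ℂ → E, Continuous b ∧
      ∀ z ∈ sphere (0 : ℂ) 1, b z ∈ U \ {x₀} ∧ g (b z) = ε * z) : ¬ PlanarAt R x₀ := by
  rintro ⟨φ, ψ, r₀, c₀⟩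
  obtain ⟨r, c, hr⟩ := c₀.exists_subset hW
  have hψ : Set.MapsTo ψ (ball 0 r \ {0}) (W \ {x₀}) := by
    rintro z ⟨hz, hz0⟩
    refine ⟨hr ⟨z, hz, rfl⟩, fun h0 => hz0 ?_⟩
    rw [Set.mem_singleton_iff, ← c.map_zero] at h0
    have := congrArg φ h0
    rwa [c.left_inv z hz, c.left_inv 0 (mem_ball_self c.pos)] at this
  have hψc := c.continuousOn_symm.mono (Set.sdiff_subset (t := {0}))
  obtain ⟨m, h₁, hc₁, he₁⟩ := exists_eq_zpow_mul_exp (f := f ∘ ψ) (hf.comp_continuousOn hψc)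
    fun z hz => hf0 _ (hψ hz)
  obtain ⟨k, h₂, hc₂, he₂⟩ := exists_eq_zpow_mul_exp (f := g ∘ ψ) (hg.comp_continuousOn hψc)
    fun z hz => hg0 _ (hψ hz)
  have hfy : ∀ y ∈ ψ '' ball 0 r \ {x₀}, f y = φ y ^ m * Complex.exp (h₁ (φ y)) := fun y hy => by
    rw [← he₁ _ (c.mapsTo_punctured hy), Function.comp_apply, c.right_inv hy.1]
  have hgy : ∀ y ∈ ψ '' ball 0 r \ {x₀}, g y = φ y ^ k * Complex.exp (h₂ (φ y)) := fun y hy => by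
    rw [← he₂ _ (c.mapsTo_punctured hy), Function.comp_apply, c.right_inv hy.1]
  have hφc := c.continuousOn.mono (Set.sdiff_subset (t := {x₀}))
  -- on the first loop, `f ^ k / g ^ m` winds `k` times
  have hk : k = 0 := by
    obtain ⟨ε, hε, a, hac, ha⟩ := ha _ c.image_mem
    have hε0 : (ε : ℂ) ≠ 0 := Complex.ofReal_ne_zero.2 hε.ne'
    have hmem : Set.MapsTo a (sphere 0 1) (ψ '' ball 0 r \ {x₀}) := fun z hz => (ha z hz).1
    have hφa : ContinuousOn (fun z => φ (a z)) (sphere 0 1) := hφc.comp hac.continuousOn hmem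
    have hφm : Set.MapsTo (fun z => φ (a z)) (sphere 0 1) (ball 0 r \ {0}) := fun z hz =>
      c.mapsTo_punctured (hmem hz)
    have hslit : ∀ z ∈ sphere (0 : ℂ) 1, (|z.im| - z.re * Complex.I : ℂ) ∈ Complex.slitPlane := by
      intro z hz
      rw [Complex.mem_slitPlane_iff]
      by_cases h0 : z.im = 0
      · right
        intro h1
        have h2 : z.re = 0 := by simpa using h1
        have : z = 0 := Complex.ext h2 h0
        simp [this] at hz
      · left
        simpa using h0
    have hw : ∀ z ∈ sphere (0 : ℂ) 1, (z.re + |z.im| * Complex.I : ℂ) =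
        Complex.exp (Complex.log (|z.im| - z.re * Complex.I) + Complex.log Complex.I) := by
      intro z hz
      rw [Complex.exp_add, Complex.exp_log (Complex.slitPlane_ne_zero (hslit z hz)),
        Complex.exp_log Complex.I_ne_zero]
      linear_combination z.re * Complex.I_sq
    refine eq_zero_of_zpow_eq_exp (H := fun z => m * (Complex.log ε +
      (Complex.log (|z.im| - z.re * Complex.I) + Complex.log Complex.I)) + k * h₁ (φ (a z))
        - m * h₂ (φ (a z)) - k * Complex.log ε) ?_ fun z hz => ?_
    · refine ContinuousOn.sub (ContinuousOn.sub (ContinuousOn.add ?_ ?_) ?_) continuousOn_const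
      · refine continuousOn_const.mul (continuousOn_const.add (ContinuousOn.add ?_
          continuousOn_const))
        exact ContinuousOn.clog (by fun_prop) hslit
      · exact continuousOn_const.mul (hc₁.comp hφa hφm)
      · exact continuousOn_const.mul (hc₂.comp hφa hφm)
    · obtain ⟨hy, hfz, hgz⟩ := ha z hz
      rw [hfy _ hy] at hfz
      rw [hgy _ hy, hw z hz] at hgz
      set ζ := φ (a z) with hζ
      have hζ0 : ζ ≠ 0 := (hφm hz).2
      have e1 := congrArg (· ^ k) hfz
      have e2 := congrArg (· ^ m) hgz
      simp only [mul_zpow, ← zpow_mul, ← Complex.exp_int_mul] at e1 e2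
      rw [mul_comm k m] at e2
      rw [Complex.exp_sub, Complex.exp_sub, Complex.exp_add, mul_add (m : ℂ), Complex.exp_add,
        Complex.exp_int_mul (Complex.log ε) m, Complex.exp_int_mul (Complex.log ε) k,
        Complex.exp_log hε0, ← e2, eq_div_iff (zpow_ne_zero _ hε0), mul_comm (z ^ k), ← e1]
      field_simp [Complex.exp_ne_zero]
  subst hk
  -- so `g` has a logarithm, but it winds once along the second loop
  obtain ⟨ε, hε, b, hbc, hb⟩ := hb _ c.image_mem
  have hε0 : (ε : ℂ) ≠ 0 := Complex.ofReal_ne_zero.2 hε.ne'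
  have hmem : Set.MapsTo b (sphere 0 1) (ψ '' ball 0 r \ {x₀}) := fun z hz => (hb z hz).1
  refine one_ne_zero (eq_zero_of_zpow_eq_exp (n := 1)
    (H := fun z => h₂ (φ (b z)) - Complex.log ε) ?_ fun z hz => ?_)
  · exact (hc₂.comp (hφc.comp hbc.continuousOn hmem) fun z hz =>
      c.mapsTo_punctured (hmem hz)).sub continuousOn_const
  · have := hgy _ (hb z hz).1
    rw [(hb z hz).2, zpow_zero, one_mul] at this
    rw [zpow_one, Complex.exp_sub, ← this, Complex.exp_log hε0, mul_div_cancel_left₀ _ hε0]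

lemma OpenPartialHomeomorph.planarAt (e : OpenPartialHomeomorph R ℂ) {x : R} (hx : x ∈ e.source) :
    PlanarAt R x := by
  classical
  obtain ⟨r, hr, hrt⟩ := Metric.mem_nhds_iff.1 (e.open_target.mem_nhds (e.map_source hx))
  have hball : ∀ z ∈ ball (0 : ℂ) r, z + e x ∈ e.target := fun z hz => hrt (by
    rwa [mem_ball_iff_norm, add_sub_cancel_right, ← mem_ball_zero_iff])
  have himg : (fun z => ((e.symm (z + e x) : R) : E)) '' ball 0 r =
      Subtype.val '' (e.symm '' ball (e x) r) := by
    rw [← Set.image_comp]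
    ext y
    constructor
    · rintro ⟨z, hz, rfl⟩
      exact ⟨z + e x, by rwa [mem_ball_iff_norm, add_sub_cancel_right, ← mem_ball_zero_iff], rfl⟩
    · rintro ⟨z, hz, rfl⟩
      refine ⟨z - e x, by rwa [mem_ball_zero_iff, ← mem_ball_iff_norm], ?_⟩
      simp
  refine ⟨fun y => if h : y ∈ R then e ⟨y, h⟩ - e x else 0, fun z => (e.symm (z + e x) : R), r,
    hr, ?_, fun z _ => Subtype.coe_prop _, ?_, fun z hz => ?_, ?_, ?_⟩
  · exact continuous_subtype_val.comp_continuousOn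
      (e.continuousOn_symm.comp (by fun_prop) hball)
  · simp [e.left_inv hx]
  · simp [e.right_inv (hball z hz)]
  · rw [himg]
    rintro _ ⟨_, ⟨w, hw, rfl⟩, rfl⟩
    rw [ContinuousWithinAt, ← IsEmbedding.subtypeVal.map_nhdsWithin_eq, Filter.tendsto_map'_iff]
    have : (fun y => if h : y ∈ R then e ⟨y, h⟩ - e x else 0) ∘ Subtype.val =
        fun y : R => e y - e x := by
      ext y
      simp
    rw [this]
    simp only [Subtype.coe_prop, dif_pos]
    exact ((e.continuousAt (e.map_target (hrt hw))).sub continuousAt_const).continuousWithinAt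
  · rw [himg, nhdsWithin_eq_map_subtype_coe x.2]
    refine Filter.image_mem_map ?_
    have := e.symm.image_mem_nhds (x := e x) (e.map_source hx) (ball_mem_nhds _ hr)
    rwa [e.left_inv hx] at this

end

lemma planarAt_of_homeomorph {S : Type*} [TopologicalSpace S]
    [ChartedSpace (EuclideanSpace ℝ (Fin 2)) S] {E : Type*} [TopologicalSpace E] {R : Set E}
    (t : R ≃ₜ S) {x : E} (hx : x ∈ R) : PlanarAt R x := by
  let e : OpenPartialHomeomorph R ℂ := (t.toOpenPartialHomeomorph.trans
    (chartAt (EuclideanSpace ℝ (Fin 2)) (t ⟨x, hx⟩))).trans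
      Complex.orthonormalBasisOneI.repr.symm.toHomeomorph.toOpenPartialHomeomorph
  exact e.planarAt (x := ⟨x, hx⟩) (by simp [e])

/-! ### Finite sets do not separate a surface -/

lemma isPreconnected_ball_diff_center {F : Type*} [NormedAddCommGroup F] [InnerProductSpace ℝ F]
    (hF : 1 < Module.rank ℝ F) (c : F) {r : ℝ} (hr : 0 < r) : IsPreconnected (ball c r \ {c}) := by
  have h1 := (isConnected_compl_singleton_of_one_lt_rank hF (0 : F)).isPreconnected
  have h2 := h1.image (OpenPartialHomeomorph.univBall c r)
    (OpenPartialHomeomorph.continuous_univBall c r).continuousOn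
  convert h2 using 1
  have h3 := (OpenPartialHomeomorph.univBall c r).image_source_eq_target
  rw [OpenPartialHomeomorph.univBall_source, OpenPartialHomeomorph.univBall_target c hr] at h3
  have hinj : Function.Injective (OpenPartialHomeomorph.univBall c r) := by
    have := (OpenPartialHomeomorph.univBall c r).injOn
    rw [OpenPartialHomeomorph.univBall_source] at this
    exact Set.injOn_univ.1 this
  rw [Set.compl_eq_univ_sdiff, Set.image_sdiff hinj, h3, Set.image_singleton,
    OpenPartialHomeomorph.univBall_apply_zero]

section

variable {S : Type*} [TopologicalSpace S] [ChartedSpace (EuclideanSpace ℝ (Fin 2)) S]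

variable (S) in
lemma exists_punctured_nhds (x : S) {W : Set S} (hW : W ∈ 𝓝 x) :
    ∃ U ∈ 𝓝 x, U ⊆ W ∧ IsPreconnected (U \ {x}) ∧ (U \ {x}).Nonempty := by
  let e := chartAt (EuclideanSpace ℝ (Fin 2)) x
  have hx : x ∈ e.source := mem_chart_source _ x
  have h1 : e.target ∩ e.symm ⁻¹' W ∈ 𝓝 (e x) := by
    refine Filter.inter_mem (e.open_target.mem_nhds (e.map_source hx)) ?_
    exact (e.continuousAt_symm (e.map_source hx)) (by rwa [e.left_inv hx])
  obtain ⟨r, hr, hrt⟩ := Metric.mem_nhds_iff.1 h1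
  have himg : e.symm '' ball (e x) r \ {x} = e.symm '' (ball (e x) r \ {e x}) := by
    ext y
    constructor
    · rintro ⟨⟨z, hz, rfl⟩, hne⟩
      refine ⟨z, ⟨hz, fun h0 => hne ?_⟩, rfl⟩
      rw [Set.mem_singleton_iff] at h0 ⊢
      rw [h0, e.left_inv hx]
    · rintro ⟨z, ⟨hz, hne⟩, rfl⟩
      refine ⟨⟨z, hz, rfl⟩, fun h0 => hne ?_⟩
      rw [Set.mem_singleton_iff] at h0 ⊢
      rw [← h0, e.right_inv (hrt hz).1]
  have hrank : 1 < Module.rank ℝ (EuclideanSpace ℝ (Fin 2)) := by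
    exact_mod_cast Module.lt_rank_of_lt_finrank (R := ℝ) (n := 1)
      (M := EuclideanSpace ℝ (Fin 2)) (by simp)
  refine ⟨e.symm '' ball (e x) r, ?_, ?_, ?_, ?_⟩
  · have := e.symm.image_mem_nhds (x := e x) (e.map_source hx) (ball_mem_nhds _ hr)
    rwa [e.left_inv hx] at this
  · rintro _ ⟨z, hz, rfl⟩
    exact (hrt hz).2
  · rw [himg]
    exact (isPreconnected_ball_diff_center hrank _ hr).image _
      (e.continuousOn_symm.mono fun z hz => (hrt hz.1).1)
  · rw [himg]
    refine Set.Nonempty.image _ ?_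
    obtain ⟨v, hv⟩ := (NormedSpace.sphere_nonempty (E := EuclideanSpace ℝ (Fin 2)) (x := e x)
      (r := r / 2)).2 (by positivity)
    rw [mem_sphere] at hv
    refine ⟨v, by rw [mem_ball]; linarith, ?_⟩
    rintro rfl
    rw [dist_self] at hv
    linarith

/-- Finitely many points do not separate a connected surface. -/
lemma eq_univ_or_eq_univ_of_finite_inter [T1Space S] [ConnectedSpace S] {A B : Set S}
    (hA : IsClosed A) (hB : IsClosed B) (hAB : A ∪ B = Set.univ) (hfin : (A ∩ B).Finite) :
    A = Set.univ ∨ B = Set.univ := by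
  -- the interiors of `A` and `B` are complementary open sets
  have hcov : interior A ∪ interior B = Set.univ := by
    refine Set.eq_univ_of_forall fun x => ?_
    obtain ⟨U, hU, hUW, hconn, -⟩ := exists_punctured_nhds S x
      (W := ((A ∩ B) \ {x})ᶜ) ((hfin.subset Set.sdiff_subset).isClosed.isOpen_compl.mem_nhds
        (by simp))
    have hsub : ∀ C : Set S, IsClosed C → U \ {x} ⊆ C → x ∈ interior C := by
      intro C hC hUC
      rw [mem_interior_iff_mem_nhds]
      suffices x ∈ C by
        filter_upwards [hU] with y hy
        by_cases hyx : y = x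
        · rwa [hyx]
        · exact hUC ⟨hy, hyx⟩
      rw [← hC.closure_eq, mem_closure_iff_nhds]
      intro N hN
      obtain ⟨U', -, hU'W, -, y, hy⟩ := exists_punctured_nhds S x (Filter.inter_mem hN hU)
      exact ⟨y, (hU'W hy.1).1, hUC ⟨(hU'W hy.1).2, hy.2⟩⟩
    have := isPreconnected_iff_subset_of_disjoint_closed.1 hconn A B hA hB
      (by rw [hAB]; exact Set.subset_univ _) (by
        rw [Set.eq_empty_iff_forall_notMem]
        rintro y ⟨hy, hyAB⟩
        exact hUW hy.1 ⟨hyAB, hy.2⟩)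
    exact this.imp (hsub A hA) (hsub B hB)
  have hdisj : interior A ∩ interior B = ∅ := by
    by_contra hne
    obtain ⟨x, hx⟩ := Set.nonempty_iff_ne_empty.2 hne
    have hfin' : ((interior A ∩ interior B) \ {x}).Finite :=
      hfin.subset (Set.sdiff_subset.trans (Set.inter_subset_inter interior_subset interior_subset))
    obtain ⟨U, -, hUW, -, y, hy⟩ := exists_punctured_nhds S x
      (Filter.inter_mem ((isOpen_interior.inter isOpen_interior).mem_nhds hx)
        (hfin'.isClosed.isOpen_compl.mem_nhds (by simp)))
    exact (hUW hy.1).2 ⟨(hUW hy.1).1, hy.2⟩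
  have := isPreconnected_iff_subset_of_disjoint.1 (isPreconnected_univ (α := S)) _ _
    isOpen_interior isOpen_interior hcov.ge (by rw [hdisj, Set.inter_empty])
  exact this.imp (fun h => Set.eq_univ_of_univ_subset (h.trans interior_subset))
    (fun h => Set.eq_univ_of_univ_subset (h.trans interior_subset))

end

/-! ### Local structure of geometric realizations -/

namespace PreAbstractSimplicialComplex

variable {V : Type*} {K : PreAbstractSimplicialComplex V}

lemma nonempty_of_mem_faces {s : Finset V} (hs : s ∈ K.faces) : s.Nonempty :=
  (K.isRelLowerSet_faces hs).1

lemma mem_faces_of_subset {s t : Finset V} (ht : t ∈ K.faces) (hst : s ⊆ t) (hs : s.Nonempty) :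
    s ∈ K.faces :=
  (K.isRelLowerSet_faces ht).2 hst hs

open Classical in
/-- The barycentre of the face `s`. -/
noncomputable def barycenter (s : Finset V) : V → ℝ := fun v => if v ∈ s then (s.card : ℝ)⁻¹ else 0

lemma barycenter_pair_apply [DecidableEq V] {a b : V} (hab : a ≠ b) :
    barycenter {a, b} a = 1 / 2 ∧ barycenter {a, b} b = 1 / 2 := by
  simp [barycenter, Finset.card_pair hab]

variable [Fintype V]

/-- The closed face of the standard simplex on `V` spanned by `t`. -/
def closedFace (t : Finset V) : Set (V → ℝ) :=
  {x | x ∈ stdSimplex ℝ V ∧ ∀ v, x v ≠ 0 → v ∈ t}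

lemma convex_closedFace (t : Finset V) : Convex ℝ (closedFace t) := by
  intro x hx y hy a b ha hb hab
  refine ⟨convex_stdSimplex ℝ V hx.1 hy.1 ha hb hab, fun v hv => ?_⟩
  by_contra hvt
  have h1 : x v = 0 := not_not.1 fun h => hvt (hx.2 v h)
  have h2 : y v = 0 := not_not.1 fun h => hvt (hy.2 v h)
  simp [h1, h2] at hv

lemma isClosed_closedFace (t : Finset V) : IsClosed (closedFace t) := by
  have : closedFace t = stdSimplex ℝ V ∩ ⋂ v ∉ t, {x : V → ℝ | x v = 0} := by
    ext x
    simp only [closedFace, Set.mem_inter_iff, Set.mem_iInter, Set.mem_ofPred_eq]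
    refine and_congr_right fun _ => forall_congr' fun v => ?_
    rw [not_imp_comm]
  rw [this]
  exact (isClosed_stdSimplex ℝ V).inter (isClosed_biInter fun v _ =>
    isClosed_eq (continuous_apply v) continuous_const)

lemma closedFace_mono {s t : Finset V} (h : s ⊆ t) : closedFace s ⊆ closedFace t :=
  fun _ hx => ⟨hx.1, fun v hv => h (hx.2 v hv)⟩

lemma sum_eq_one_of_mem_closedFace {t : Finset V} {x : V → ℝ} (hx : x ∈ closedFace t) :
    ∑ v ∈ t, x v = 1 := by
  rw [← hx.1.2]
  exact Finset.sum_subset (Finset.subset_univ t) fun v _ hv => not_not.1 fun h => hv (hx.2 v h)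

lemma barycenter_mem_closedFace {s : Finset V} (hs : s.Nonempty) :
    barycenter s ∈ closedFace s := by
  classical
  have hc : (s.card : ℝ) ≠ 0 := Nat.cast_ne_zero.2 hs.card_pos.ne'
  refine ⟨⟨fun v => ?_, ?_⟩, fun v hv => ?_⟩
  · unfold barycenter
    split_ifs
    · positivity
    · exact le_rfl
  · simp [barycenter, Finset.sum_ite_mem, hc]
  · by_contra h
    simp [barycenter, h] at hv

lemma subset_of_barycenter_mem {s t : Finset V} (h : barycenter s ∈ closedFace t) : s ⊆ t := by
  intro v hv
  refine h.2 v ?_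
  have : (s.card : ℝ) ≠ 0 := Nat.cast_ne_zero.2 (Finset.card_pos.2 ⟨v, hv⟩).ne'
  simp [barycenter, hv, this]

lemma subset_of_mem_ball {s t : Finset V} {y : V → ℝ} (hy : y ∈ closedFace t)
    (hys : y ∈ ball (barycenter s) (s.card : ℝ)⁻¹) : s ⊆ t := by
  intro v hv
  refine hy.2 v fun h0 => ?_
  have h1 := (dist_le_pi_dist y (barycenter s) v).trans_lt hys
  simp only [barycenter, hv, if_true, h0, Real.dist_eq, zero_sub, abs_neg] at h1
  exact lt_irrefl _ ((le_abs_self _).trans_lt h1)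

lemma mem_realization_iff {x : V → ℝ} : x ∈ K.realization ↔ ∃ s ∈ K.faces, x ∈ closedFace s :=
  ⟨fun ⟨hx, s, hs, h⟩ => ⟨s, hs, hx, h⟩, fun ⟨s, hs, hx, h⟩ => ⟨hx, s, hs, h⟩⟩

/-- If all faces containing `s` are contained in `t`, then `K` agrees with `t` near the barycentre
of `s`. -/
lemma mem_closedFace_of_unique {s t : Finset V} (hst : ∀ u ∈ K.faces, s ⊆ u → u ⊆ t)
    {y : V → ℝ} (hy : y ∈ K.realization) (hys : y ∈ ball (barycenter s) (s.card : ℝ)⁻¹) :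
    y ∈ closedFace t := by
  obtain ⟨u, hu, hyu⟩ := mem_realization_iff.1 hy
  exact closedFace_mono (hst u hu (subset_of_mem_ball hyu hys)) hyu

lemma not_planarAt_of_unique {s t : Finset V} (hs : s.Nonempty) (ht : t ∈ K.faces)
    (hst : ∀ u ∈ K.faces, s ⊆ u → u ⊆ t)
    (hlog : ∀ δ : ℝ, 0 < δ → HasLogs ((closedFace t ∩ ball (barycenter s) δ) \ {barycenter s})) :
    ¬ PlanarAt K.realization (barycenter s) := by
  refine not_planarAt_of_hasLogs fun W hW => ?_
  obtain ⟨ε, hε, hεW⟩ := Metric.mem_nhdsWithin_iff.1 hW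
  have hs0 : 0 < (s.card : ℝ)⁻¹ := inv_pos.2 (Nat.cast_pos.2 hs.card_pos)
  have hmin := lt_min hε hs0
  refine ⟨closedFace t ∩ ball (barycenter s) (min ε (s.card : ℝ)⁻¹), ?_, ?_, hlog _ hmin⟩
  · refine Filter.mem_of_superset (inter_mem_nhdsWithin _ (ball_mem_nhds _ hmin)) ?_
    rintro y ⟨hy, hyb⟩
    exact ⟨mem_closedFace_of_unique hst hy (ball_subset_ball (min_le_right _ _) hyb), hyb⟩
  · rintro y ⟨hy, hyb⟩
    exact hεW ⟨ball_subset_ball (min_le_left _ _) hyb, mem_realization_iff.2 ⟨t, ht, hy⟩⟩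

/-- The barycentre of a proper face `s` of the only maximal face `t` containing `s` is a boundary
point: its punctured neighbourhoods are star-shaped about a point of `t` which is not in `s`. -/
lemma not_planarAt_of_ssubset {s t : Finset V} (hs : s.Nonempty) (ht : t ∈ K.faces)
    (hst : ∀ u ∈ K.faces, s ⊆ u → u ⊆ t) (hss : s ⊂ t) :
    ¬ PlanarAt K.realization (barycenter s) := by
  classical
  refine not_planarAt_of_unique hs ht hst fun δ hδ => ?_
  obtain ⟨c, hct, hcs⟩ := Finset.exists_of_ssubset hss
  set x₀ := barycenter s with hx₀
  have hx₀t : x₀ ∈ closedFace t := closedFace_mono hss.1 (barycenter_mem_closedFace hs)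
  have hct' : ({c} : Finset V) ⊆ t := Finset.singleton_subset_iff.2 hct
  have hpt : barycenter {c} ∈ closedFace t :=
    closedFace_mono hct' (barycenter_mem_closedFace (Finset.singleton_nonempty c))
  have hx₀c : x₀ c = 0 := by simp [hx₀, barycenter, hcs]
  have hpc : barycenter {c} c = 1 := by simp [barycenter]
  set p := barycenter {c} with hp
  obtain ⟨η, hη0, hη1, hηδ⟩ : ∃ η : ℝ, 0 < η ∧ η ≤ 1 ∧ η * dist x₀ p < δ := by
    have hd : 0 ≤ dist x₀ p := dist_nonneg
    refine ⟨min 1 (δ / (dist x₀ p + 1)), by positivity, min_le_left _ _, ?_⟩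
    calc _ ≤ δ / (dist x₀ p + 1) * dist x₀ p :=
          mul_le_mul_of_nonneg_right (min_le_right _ _) hd
      _ < δ := by
        rw [div_mul_eq_mul_div, div_lt_iff₀ (by positivity)]
        nlinarith
  set q := AffineMap.lineMap x₀ p η with hq
  have hqc : q c = η := by
    simp [hq, AffineMap.lineMap_apply, hx₀c, hpc]
  have hqU : q ∈ closedFace t ∩ ball x₀ δ := by
    refine ⟨(convex_closedFace t).lineMap_mem hx₀t hpt ⟨hη0.le, hη1⟩, ?_⟩
    rw [mem_ball, dist_lineMap_left, Real.norm_of_nonneg hη0.le]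
    exact hηδ
  refine StarConvex.hasLogs (q := q) fun y hy a b ha hb hab => ⟨?_, fun h0 => hy.2 ?_⟩
  · exact ((convex_closedFace t).inter (convex_ball x₀ δ)) hqU hy.1 ha hb hab
  · rw [Set.mem_singleton_iff] at h0 ⊢
    have h1 := congrFun h0 c
    simp only [Pi.add_apply, Pi.smul_apply, smul_eq_mul, hqc, hx₀c] at h1
    have hyc := hy.1.1.1.1 c
    have ha0 : a = 0 := by
      have h3 := mul_nonneg ha hη0.le
      have h4 := mul_nonneg hb hyc
      have h5 : a * η = 0 := by linarith
      exact (mul_eq_zero.1 h5).resolve_right hη0.ne'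
    rw [ha0, zero_add] at hab
    rw [← h0, ha0, hab]; simp

/-- A maximal vertex is an isolated point. -/
lemma not_planarAt_of_card_one {s : Finset V} (hs : s ∈ K.faces)
    (hmax : ∀ u ∈ K.faces, s ⊆ u → u ⊆ s) (hcard : s.card = 1) :
    ¬ PlanarAt K.realization (barycenter s) := by
  refine not_planarAt_of_unique (nonempty_of_mem_faces hs) hs hmax fun δ hδ => ?_
  have : (closedFace s ∩ ball (barycenter s) δ) \ {barycenter s} = ∅ := by
    rw [Set.eq_empty_iff_forall_notMem]
    rintro y ⟨⟨hy, -⟩, hne⟩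
    obtain ⟨v, rfl⟩ := Finset.card_eq_one.1 hcard
    refine hne ?_
    rw [Set.mem_singleton_iff]
    ext w
    by_cases hw : w = v
    · subst hw
      simpa [barycenter] using sum_eq_one_of_mem_closedFace hy
    · have : y w = 0 := not_not.1 fun h => hw (Finset.mem_singleton.1 (hy.2 w h))
      simp [barycenter, hw, this]
  rw [this]
  exact (starConvex_empty 0).hasLogs

lemma eq_barycenter_pair [DecidableEq V] {a b : V} (hab : a ≠ b) {y : V → ℝ}
    (hy : y ∈ closedFace {a, b}) (h : y a = y b) : y = barycenter {a, b} := by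
  ext w
  have h1 := sum_eq_one_of_mem_closedFace hy
  rw [Finset.sum_pair hab] at h1
  by_cases hw : w ∈ ({a, b} : Finset V)
  · have h2 : y w = 1 / 2 := by
      rcases Finset.mem_insert.1 hw with rfl | hw
      · linarith
      · rw [Finset.mem_singleton.1 hw]; linarith
    simp only [barycenter, hw, if_true, h2, Finset.card_pair hab]
    norm_num
  · have : y w = 0 := not_not.1 fun h => hw (hy.2 w h)
    simp only [barycenter, hw, if_false, this]

/-- Removing the midpoint of a maximal edge leaves two convex pieces. -/
lemma not_planarAt_of_card_two {s : Finset V} (hs : s ∈ K.faces)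
    (hmax : ∀ u ∈ K.faces, s ⊆ u → u ⊆ s) (hcard : s.card = 2) :
    ¬ PlanarAt K.realization (barycenter s) := by
  classical
  refine not_planarAt_of_unique (nonempty_of_mem_faces hs) hs hmax fun δ hδ => ?_
  obtain ⟨a, b, hab, rfl⟩ := Finset.card_eq_two.1 hcard
  have hlog : ∀ U : Set (V → ℝ), Convex ℝ U → barycenter {a, b} ∉ U →
      HasLogs (((closedFace {a, b} ∩ ball (barycenter {a, b}) δ) \ {barycenter {a, b}}) ∩ U) := by
    intro U hU hn
    have h1 : ((closedFace {a, b} ∩ ball (barycenter {a, b}) δ) \ {barycenter {a, b}}) ∩ U =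
        (closedFace {a, b} ∩ ball (barycenter {a, b}) δ) ∩ U := by
      ext y
      simp only [Set.mem_inter_iff, Set.mem_sdiff, Set.mem_singleton_iff]
      constructor
      · tauto
      · rintro ⟨h1, h2⟩
        exact ⟨⟨h1, fun h => hn (h ▸ h2)⟩, h2⟩
    rw [h1]
    rcases Set.eq_empty_or_nonempty
      ((closedFace {a, b} ∩ ball (barycenter {a, b}) δ) ∩ U) with h0 | ⟨q, hq⟩
    · rw [h0]
      exact (starConvex_empty 0).hasLogs
    · exact ((((convex_closedFace _).inter (convex_ball _ _)).inter hU).starConvex hq).hasLogs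
  have hU : ∀ c d : V, IsOpen {y : V → ℝ | y c < y d} ∧ Convex ℝ {y : V → ℝ | y c < y d} := by
    intro c d
    refine ⟨isOpen_lt (continuous_apply c) (continuous_apply d), ?_⟩
    have hlin : IsLinearMap ℝ fun y : V → ℝ => y c - y d :=
      ⟨fun x y => by simp only [Pi.add_apply]; ring,
        fun r x => by simp only [Pi.smul_apply, smul_eq_mul]; ring⟩
    simpa only [sub_neg] using convex_halfSpace_lt hlin 0
  obtain ⟨ha, hb⟩ := barycenter_pair_apply hab
  refine HasLogs.of_cover (hU a b).1 (hU b a).1 (hlog _ (hU a b).2 (by simp [ha, hb]))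
    (hlog _ (hU b a).2 (by simp [ha, hb])) ?_ ?_
  · rintro y ⟨⟨hy, -⟩, hne⟩
    rcases lt_trichotomy (y a) (y b) with h | h | h
    · exact Or.inl h
    · exact absurd (eq_barycenter_pair hab hy h) hne
    · exact Or.inr h
  · convert isPreconnected_empty
    rw [Set.eq_empty_iff_forall_notMem]
    rintro y ⟨-, h1, h2⟩
    exact lt_asymm (show y a < y b from h1) h2

end PreAbstractSimplicialComplex

/-! ### Faces of high dimension and books of triangles -/

namespace PreAbstractSimplicialComplex

variable {V : Type*} {K : PreAbstractSimplicialComplex V}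

open Classical in
/-- The loop around the midpoint of the edge `{a, b}` in the two pages `{a, b, c}` and
`{a, b, d}`, parametrised by the circle. -/
noncomputable def pageLoop (a b c d : V) (ε : ℝ) (z : ℂ) : V → ℝ := fun v =>
  if v = a then 1 / 2 + ε * (z.re - |z.im|) / 2
  else if v = b then 1 / 2 + ε * (-z.re - |z.im|) / 2
  else if v = c then ε * max z.im 0
  else if v = d then ε * max (-z.im) 0
  else 0

lemma continuous_pageLoop (a b c d : V) (ε : ℝ) : Continuous (pageLoop a b c d ε) := by
  refine continuous_pi fun v => ?_
  have hre := Complex.continuous_re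
  have him := Complex.continuous_im
  unfold pageLoop
  split_ifs <;> fun_prop

variable [Fintype V]

/-- Near its barycentre a maximal face of dimension `d` is identified with `ℝ ^ d` by dropping one
barycentric coordinate, and for `d ≥ 3` every function without zeros on `ℝ ^ d \ {0}` has a
logarithm. -/
lemma not_planarAt_of_four_le_card {s : Finset V} (hs : s ∈ K.faces)
    (hmax : ∀ u ∈ K.faces, s ⊆ u → u ⊆ s) (hcard : 4 ≤ s.card) :
    ¬ PlanarAt K.realization (barycenter s) := by
  classical
  refine not_planarAt_of_hasLogs fun W hW => ?_
  obtain ⟨ε, hε, hεW⟩ := Metric.mem_nhdsWithin_iff.1 hW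
  have hs0 : 0 < (s.card : ℝ) := Nat.cast_pos.2 (by omega)
  obtain ⟨δ, hδ, hδε, hδs⟩ : ∃ δ : ℝ, 0 < δ ∧ δ ≤ ε ∧ δ ≤ (s.card : ℝ)⁻¹ :=
    ⟨min ε (s.card : ℝ)⁻¹, by positivity, min_le_left _ _, min_le_right _ _⟩
  obtain ⟨a, ha⟩ := nonempty_of_mem_faces hs
  let ι := {v // v ∈ s.erase a}
  have hι : (Fintype.card ι : ℝ) + 1 = s.card := by
    rw [Fintype.card_coe, ← Finset.card_erase_add_one ha]; push_cast; rfl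
  let x₀ : V → ℝ := barycenter s
  have hx₀ : ∀ v ∈ s, x₀ v = (s.card : ℝ)⁻¹ := fun v hv => by simp [x₀, barycenter, hv]
  have hx₀' : ∀ v ∉ s, x₀ v = 0 := fun v hv => by simp [x₀, barycenter, hv]
  -- coordinates centred at the barycentre, and the inverse parametrisation of the face
  let w : (V → ℝ) → (ι → ℝ) := fun y v => y v.1 - x₀ v.1
  have hw : Continuous w := by fun_prop
  let L : (ι → ℝ) → V → ℝ := fun u v =>
    x₀ v + if h : v ∈ s.erase a then u ⟨v, h⟩ else if v = a then -∑ i, u i else 0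
  have hL : Continuous L := by
    refine continuous_pi fun v => continuous_const.add ?_
    split_ifs <;> fun_prop
  have hLι : ∀ u (i : ι), L u i.1 = x₀ i.1 + u i := fun u i => by
    have : i.1 ∈ s.erase a := i.2
    simp only [L, dif_pos this]
    rfl
  have hLa : ∀ u, L u a = x₀ a - ∑ i, u i := fun u => by
    simp [L, sub_eq_add_neg]
  have hLn : ∀ u, ∀ v ∉ s, L u v = 0 := fun u v hv => by
    have h1 : v ∉ s.erase a := fun h => hv (Finset.mem_of_mem_erase h)
    have h2 : v ≠ a := fun h => hv (h ▸ ha)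
    simp only [L, dif_neg h1, if_neg h2, hx₀' v hv, add_zero]
  have hsum : ∀ y : V → ℝ, ∑ v ∈ s, y v = y a + ∑ i : ι, y i.1 := fun y => by
    rw [← Finset.add_sum_erase s y ha, ← Finset.sum_coe_sort (s.erase a)]
  have hx₀F : x₀ ∈ closedFace s := barycenter_mem_closedFace ⟨a, ha⟩
  have hwL : ∀ u, w (L u) = u := fun u => by
    ext i
    simp [w, hLι]
  have hLw : ∀ y ∈ closedFace s, L (w y) = y := fun y hy => by
    have h1 := sum_eq_one_of_mem_closedFace hy
    have h2 := sum_eq_one_of_mem_closedFace hx₀F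
    rw [hsum] at h1 h2
    ext v
    by_cases hv : v ∈ s
    · by_cases hva : v = a
      · subst hva
        rw [hLa]
        simp only [w, Finset.sum_sub_distrib]
        linarith
      · have := hLι (w y) ⟨v, Finset.mem_erase.2 ⟨hva, hv⟩⟩
        rw [this]
        simp [w]
    · rw [hLn _ v hv]
      exact (not_not.1 fun h => hv (hy.2 v h)).symm
  -- the scale at which `L` stays in the ball of radius `δ`
  set r : ℝ := δ / s.card with hr
  have hr0 : 0 < r := by positivity
  have hrδ : r ≤ δ := by
    rw [hr, div_le_iff₀ hs0]
    have : (1 : ℝ) ≤ s.card := by exact_mod_cast (by omega : 1 ≤ s.card)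
    nlinarith
  have hLδ : ∀ u : ι → ℝ, ‖u‖ < r → ∀ v, |L u v - x₀ v| < δ := by
    intro u hu v
    by_cases hv : v ∈ s
    · by_cases hva : v = a
      · subst hva
        rw [hLa, sub_sub_cancel_left, abs_neg]
        calc |∑ i, u i| ≤ ∑ i, |u i| := Finset.abs_sum_le_sum_abs _ _
          _ ≤ ∑ _i : ι, ‖u‖ := Finset.sum_le_sum fun i _ => norm_le_pi_norm u i
          _ = Fintype.card ι * ‖u‖ := by simp
          _ ≤ Fintype.card ι * r := by gcongr
          _ < s.card * r := by rw [← hι]; linarith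
          _ = δ := by rw [hr]; field_simp
      · have := hLι u ⟨v, Finset.mem_erase.2 ⟨hva, hv⟩⟩
        simp only at this
        rw [this, add_sub_cancel_left]
        exact ((norm_le_pi_norm u _).trans_lt hu).trans_le hrδ
    · rw [hLn _ v hv, hx₀' v hv, sub_zero, abs_zero]
      exact hδ
  have hLF : ∀ u : ι → ℝ, ‖u‖ < r → L u ∈ closedFace s := by
    intro u hu
    refine ⟨⟨fun v => ?_, ?_⟩, fun v hv => ?_⟩
    · by_cases hv : v ∈ s
      · have := (abs_lt.1 (hLδ u hu v)).1
        rw [hx₀ v hv] at this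
        linarith
      · exact (hLn u v hv).ge
    · rw [← Finset.sum_subset (Finset.subset_univ s) fun v _ hv => hLn u v hv, hsum, hLa]
      have h2 := sum_eq_one_of_mem_closedFace hx₀F
      rw [hsum] at h2
      simp only [hLι, Finset.sum_add_distrib]
      linarith
    · by_contra h
      exact hv (hLn u v h)
  have hU : {y | y ∈ closedFace s ∧ ‖w y‖ < r} ⊆ W := by
    rintro y ⟨hy, hyr⟩
    refine hεW ⟨?_, mem_realization_iff.2 ⟨s, hs, hy⟩⟩
    rw [mem_ball, dist_pi_lt_iff hε]
    intro v
    have := hLδ (w y) hyr v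
    rw [hLw y hy] at this
    exact this.trans_le hδε
  refine ⟨{y | y ∈ closedFace s ∧ ‖w y‖ < r}, ?_, hU, ?_⟩
  · have hopen : {y | ‖w y‖ < r} ∈ 𝓝 x₀ := by
      refine (isOpen_lt hw.norm continuous_const).mem_nhds ?_
      have : w x₀ = 0 := by ext i; simp [w]
      simp [this, hr0]
    refine Filter.mem_of_superset (inter_mem_nhdsWithin _
      (Filter.inter_mem hopen (ball_mem_nhds x₀ (inv_pos.2 hs0)))) ?_
    rintro y ⟨hy, hyr, hyb⟩
    exact ⟨mem_closedFace_of_unique hmax hy hyb, hyr⟩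
  · have hlog := hasLogs_compl_zero (E := ι → ℝ) (by
      rw [Module.finrank_fintype_fun_eq_card, Fintype.card_coe, Finset.card_erase_of_mem ha]
      omega)
    -- `u ↦ (r / (1 + ‖u‖)) • u` maps the whole space onto the ball of radius `r`
    have hlt : ∀ u : ι → ℝ, ‖(r / (1 + ‖u‖)) • u‖ < r := fun u => by
      have h0 := norm_nonneg u
      rw [norm_smul, Real.norm_of_nonneg (by positivity), div_mul_eq_mul_div,
        div_lt_iff₀ (by positivity)]
      nlinarith
    refine hlog.of_retract (j := fun u => L ((r / (1 + ‖u‖)) • u))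
      (k := fun y => (r - ‖w y‖)⁻¹ • w y) ?_ ?_ ?_ ?_ ?_
    · refine ContinuousOn.smul (ContinuousOn.inv₀
        (continuous_const.sub hw.norm).continuousOn fun y hy => ?_) hw.continuousOn
      exact (sub_pos.2 hy.1.2).ne'
    · rintro y ⟨⟨hy, hyr⟩, hne⟩ h0
      rw [Set.mem_singleton_iff] at h0
      have h1 : w y = 0 := (smul_eq_zero.1 h0).resolve_left (inv_ne_zero (sub_pos.2 hyr).ne')
      refine hne ?_
      rw [Set.mem_singleton_iff, ← hLw y hy, h1]
      refine Eq.trans (congrArg L ?_) (hLw x₀ hx₀F)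
      ext i
      simp [w]
    · have hc : Continuous fun u : ι → ℝ => (r / (1 + ‖u‖)) • u := by
        refine Continuous.smul (Continuous.div continuous_const
          (continuous_const.add continuous_norm) fun u => ?_) continuous_id
        exact (by positivity : (0 : ℝ) < 1 + ‖u‖).ne'
      exact (hL.comp hc).continuousOn
    · intro u hu
      refine ⟨⟨hLF _ (hlt u), by rw [hwL]; exact hlt u⟩, fun h0 => hu ?_⟩
      rw [Set.mem_singleton_iff] at h0 ⊢
      have h1 := congrArg w h0
      rw [hwL] at h1
      have h2 : w (barycenter s) = 0 := by ext i; simp [w, x₀]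
      rw [h2] at h1
      have h3 : 0 < 1 + ‖u‖ := by positivity
      exact (smul_eq_zero.1 h1).resolve_left (div_pos hr0 h3).ne'
    · rintro y ⟨⟨hy, hyr⟩, -⟩
      have h1 : 0 < r - ‖w y‖ := sub_pos.2 hyr
      have h2 : r / (1 + ‖(r - ‖w y‖)⁻¹ • w y‖) * (r - ‖w y‖)⁻¹ = 1 := by
        rw [norm_smul, norm_inv, Real.norm_of_nonneg h1.le]
        have h4 : (1 + (r - ‖w y‖)⁻¹ * ‖w y‖) = r * (r - ‖w y‖)⁻¹ := by
          field_simp; ring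
        rw [h4]
        field_simp
      rw [smul_smul, h2, one_smul, hLw y hy]

lemma exists_pageLoop [DecidableEq V] {a b c d : V} (hab : a ≠ b) (hac : a ≠ c) (had : a ≠ d)
    (hbc : b ≠ c) (hbd : b ≠ d) (hcd : c ≠ d) (hc : {a, b, c} ∈ K.faces) (hd : {a, b, d} ∈ K.faces)
    {U : Set (V → ℝ)} (hU : U ∈ 𝓝[K.realization] (barycenter {a, b})) :
    ∃ ε : ℝ, 0 < ε ∧ ∀ z ∈ sphere (0 : ℂ) 1, pageLoop a b c d ε z ∈ U := by
  obtain ⟨δ, hδ, hδU⟩ := Metric.mem_nhdsWithin_iff.1 hU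
  set ε := min (1 / 2) (δ / 2) with hε
  have hε0 : 0 < ε := by positivity
  have hε1 : ε ≤ 1 / 2 := min_le_left _ _
  have hεδ : ε < δ := (min_le_right _ _).trans_lt (by linarith)
  refine ⟨ε, hε0, fun z hz => hδU ⟨?_, ?_⟩⟩
  all_goals
    rw [mem_sphere_zero_iff_norm] at hz
    have hre := Complex.abs_re_le_norm z
    have him := Complex.abs_im_le_norm z
    rw [hz] at hre him
    have him0 := abs_nonneg z.im
  · rw [mem_ball, dist_pi_lt_iff hδ]
    have key : ∀ x : ℝ, |x| ≤ 1 → |ε * x| < δ := fun x hx => by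
      rw [abs_mul, abs_of_pos hε0]
      nlinarith [abs_nonneg x]
    have hb := abs_le.1 hre
    intro v
    rw [Real.dist_eq]
    obtain ⟨ha', hb'⟩ := barycenter_pair_apply hab
    unfold pageLoop
    split_ifs with h1 h2 h3 h4
    · rw [h1, ha', add_sub_cancel_left, mul_div_assoc]
      exact key _ (abs_le.2 ⟨by linarith, by linarith⟩)
    · rw [h2, hb', add_sub_cancel_left, mul_div_assoc]
      exact key _ (abs_le.2 ⟨by linarith, by linarith⟩)
    all_goals
      have : barycenter {a, b} v = 0 := by simp [barycenter, h1, h2]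
      rw [this, sub_zero]
    · refine key _ (abs_le.2 ⟨?_, ?_⟩)
      · linarith [le_max_right z.im 0]
      · exact max_le (abs_le.1 him).2 zero_le_one
    · refine key _ (abs_le.2 ⟨?_, ?_⟩)
      · linarith [le_max_right (-z.im) 0]
      · exact max_le (by linarith [(abs_le.1 him).1]) zero_le_one
    · simpa using hδ
  · have hb := abs_le.1 hre
    have hpos : ∀ v, 0 ≤ pageLoop a b c d ε z v := fun v => by
      unfold pageLoop
      split_ifs
      · nlinarith
      · nlinarith
      · exact mul_nonneg hε0.le (le_max_right _ _)
      · exact mul_nonneg hε0.le (le_max_right _ _)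
      · exact le_rfl
    have hsum : ∑ v, pageLoop a b c d ε z v = 1 := by
      have h1 : ∑ v ∈ {a, b, c, d}, pageLoop a b c d ε z v = ∑ v, pageLoop a b c d ε z v :=
        Finset.sum_subset (Finset.subset_univ _) fun v _ hv => by
          simp only [Finset.mem_insert, Finset.mem_singleton, not_or] at hv
          simp [pageLoop, hv]
      rw [← h1, Finset.sum_insert (by simp [hab, hac, had]), Finset.sum_insert (by simp [hbc, hbd]),
        Finset.sum_pair hcd]
      simp only [pageLoop, if_true, hab.symm, hac.symm, had.symm, hbc.symm, hbd.symm, hcd.symm,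
        if_false]
      rcases le_total 0 z.im with h | h
      · rw [max_eq_left h, max_eq_right (by linarith), abs_of_nonneg h]; ring
      · rw [max_eq_right h, max_eq_left (by linarith), abs_of_nonpos h]; ring
    refine ⟨⟨hpos, hsum⟩, ?_⟩
    rcases le_total 0 z.im with h | h
    · refine ⟨_, hc, fun v hv => ?_⟩
      by_contra hn
      simp only [Finset.mem_insert, Finset.mem_singleton, not_or] at hn
      simp [pageLoop, hn, h] at hv
    · refine ⟨_, hd, fun v hv => ?_⟩
      by_contra hn
      simp only [Finset.mem_insert, Finset.mem_singleton, not_or] at hn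
      simp [pageLoop, hn, h] at hv

/-- A surface does not look like a book with at least three pages. -/
lemma not_planarAt_of_three_pages [DecidableEq V] (hdim : ∀ t ∈ K.faces, t.card ≤ 3)
    {a b c d e : V} (hab : a ≠ b) (hac : a ≠ c) (had : a ≠ d) (hae : a ≠ e)
    (hbc : b ≠ c) (hbd : b ≠ d) (hbe : b ≠ e) (hcd : c ≠ d) (hce : c ≠ e) (hde : d ≠ e)
    (hc : {a, b, c} ∈ K.faces) (hd : {a, b, d} ∈ K.faces) (he : {a, b, e} ∈ K.faces) :
    ¬ PlanarAt K.realization (barycenter {a, b}) := by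
  -- `f` folds all pages but `c` together, `g` all pages but `c` and `d`
  let f : (V → ℝ) → ℂ := fun y =>
    ((y a - y b : ℝ) : ℂ) + ((2 * y c + y a + y b - 1 : ℝ) : ℂ) * Complex.I
  let g : (V → ℝ) → ℂ := fun y =>
    ((y a - y b : ℝ) : ℂ) + ((2 * y c + 2 * y d + y a + y b - 1 : ℝ) : ℂ) * Complex.I
  have hf : Continuous f := by fun_prop
  have hg : Continuous g := by fun_prop
  have hzero : ∀ x y : ℝ, (x : ℂ) + y * Complex.I = 0 → x = 0 ∧ y = 0 := fun x y h =>
    ⟨by simpa using congrArg Complex.re h, by simpa using congrArg Complex.im h⟩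
  have hpage : ∀ y ∈ K.realization ∩ ball (barycenter {a, b}) (({a, b} : Finset V).card : ℝ)⁻¹,
      ∃ x, x ≠ a ∧ x ≠ b ∧ y a + y b + y x = 1 ∧ (∀ v, v ≠ a → v ≠ b → v ≠ x → y v = 0) ∧
        (y x = 0 → y a = y b → y = barycenter {a, b}) := by
    rintro y ⟨hy, hyb⟩
    obtain ⟨t, ht, hyt⟩ := mem_realization_iff.1 hy
    have habt := subset_of_mem_ball hyt hyb
    obtain ⟨x, hxa, hxb, htx⟩ : ∃ x, x ≠ a ∧ x ≠ b ∧ t ⊆ {a, b, x} := by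
      have h1 := Finset.card_sdiff_add_card_eq_card habt
      rw [Finset.card_pair hab] at h1
      have h2 := hdim t ht
      rcases (t \ {a, b}).eq_empty_or_nonempty with h0 | ⟨x, hx⟩
      · refine ⟨c, hac.symm, hbc.symm, ?_⟩
        rw [Finset.sdiff_eq_empty_iff_subset] at h0
        exact h0.trans (by simp [Finset.insert_subset_iff])
      · have h3 := Finset.card_le_one.1 (by omega : (t \ {a, b}).card ≤ 1)
        have h4 := hx
        simp only [Finset.mem_sdiff, Finset.mem_insert, Finset.mem_singleton, not_or] at h4
        refine ⟨x, h4.2.1, h4.2.2, fun v hv => ?_⟩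
        by_contra hvn
        simp only [Finset.mem_insert, Finset.mem_singleton, not_or] at hvn
        exact hvn.2.2 (h3 v (by simp [hv, hvn]) x hx)
    have hyx := closedFace_mono htx hyt
    have hsum := sum_eq_one_of_mem_closedFace hyx
    rw [Finset.sum_insert (by simp [hab, hxa.symm]), Finset.sum_pair hxb.symm] at hsum
    refine ⟨x, hxa, hxb, by linarith, fun v h1 h2 h3 => ?_, fun hx0 hyab => ?_⟩
    · exact not_not.1 fun h => by simpa [h1, h2, h3] using hyx.2 v h
    · refine eq_barycenter_pair hab ⟨hyx.1, fun v hv => ?_⟩ hyab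
      have := hyx.2 v hv
      simp only [Finset.mem_insert, Finset.mem_singleton] at this ⊢
      rcases this with h | h | rfl
      · exact Or.inl h
      · exact Or.inr h
      · exact absurd hx0 hv
  have hgx₀ : g (barycenter {a, b}) = 0 := by
    obtain ⟨h1, h2⟩ := barycenter_pair_apply hab
    have h3 : barycenter {a, b} c = 0 := by simp [barycenter, hac.symm, hbc.symm]
    have h4 : barycenter {a, b} d = 0 := by simp [barycenter, had.symm, hbd.symm]
    simp [g, h1, h2, h3, h4]; norm_num
  have hfx₀ : f (barycenter {a, b}) = 0 := by
    obtain ⟨h1, h2⟩ := barycenter_pair_apply hab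
    have h3 : barycenter {a, b} c = 0 := by simp [barycenter, hac.symm, hbc.symm]
    simp [f, h1, h2, h3]; norm_num
  have hmaxim : ∀ x : ℝ, 2 * max x 0 - |x| = x := fun x => by
    rcases le_total 0 x with h | h
    · rw [max_eq_left h, abs_of_nonneg h]; ring
    · rw [max_eq_right h, abs_of_nonpos h]; ring
  have hmaxim' : ∀ x : ℝ, max x 0 + max (-x) 0 = |x| := fun x => by
    rcases le_total 0 x with h | h
    · rw [max_eq_left h, max_eq_right (by linarith), abs_of_nonneg h]; ring
    · rw [max_eq_right h, max_eq_left (by linarith), abs_of_nonpos h]; ring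
  have hz0 : ∀ z ∈ sphere (0 : ℂ) 1, z ≠ 0 := by
    rintro z hz rfl
    simp at hz
  have hpos : 0 < ((({a, b} : Finset V).card : ℝ))⁻¹ := by
    rw [Finset.card_pair hab]; norm_num
  refine not_planarAt_of_two_loops hf hg (inter_mem_nhdsWithin _ (ball_mem_nhds _ hpos))
    ?_ ?_ ?_ ?_
  · rintro y ⟨hyW, hne⟩ h0
    obtain ⟨x, hxa, hxb, hsum, hv, hx⟩ := hpage y hyW
    obtain ⟨h1, h2⟩ := hzero _ _ h0
    refine hne (hx ?_ (by linarith))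
    by_cases hxc : x = c
    · subst hxc; linarith
    · have := hv c hac.symm hbc.symm (Ne.symm hxc)
      linarith
  · rintro y ⟨hyW, hne⟩ h0
    obtain ⟨x, hxa, hxb, hsum, hv, hx⟩ := hpage y hyW
    obtain ⟨h1, h2⟩ := hzero _ _ h0
    refine hne (hx ?_ (by linarith))
    by_cases hxc : x = c
    · subst hxc
      have := hv d had.symm hbd.symm hcd.symm
      linarith
    · have h3 := hv c hac.symm hbc.symm (Ne.symm hxc)
      by_cases hxd : x = d
      · subst hxd; linarith
      · have h4 := hv d had.symm hbd.symm (Ne.symm hxd)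
        linarith
  · intro U hU
    obtain ⟨ε, hε, hl⟩ := exists_pageLoop hab hac had hbc hbd hcd hc hd hU
    have hε0 : (ε : ℂ) ≠ 0 := Complex.ofReal_ne_zero.2 hε.ne'
    refine ⟨ε, hε, pageLoop a b c d ε, continuous_pageLoop _ _ _ _ _, fun z hz => ?_⟩
    have hfz : f (pageLoop a b c d ε z) = ε * z := by
      simp only [f, pageLoop, if_true, hab.symm, hac.symm, hbc.symm, if_false]
      apply Complex.ext
      · simp; ring
      · simp
        linear_combination ε * hmaxim z.im
    refine ⟨⟨hl z hz, fun h0 => ?_⟩, hfz, ?_⟩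
    · rw [Set.mem_singleton_iff] at h0
      rw [h0, hfx₀] at hfz
      exact mul_ne_zero hε0 (hz0 z hz) hfz.symm
    · simp only [g, pageLoop, if_true, hab.symm, hac.symm, hbc.symm, had.symm, hbd.symm, hcd.symm,
        if_false]
      apply Complex.ext
      · simp; ring
      · simp
        linear_combination 2 * ε * hmaxim' z.im
  · intro U hU
    obtain ⟨ε, hε, hl⟩ := exists_pageLoop hab hac hae hbc hbe hce hc he hU
    have hε0 : (ε : ℂ) ≠ 0 := Complex.ofReal_ne_zero.2 hε.ne'
    refine ⟨ε, hε, pageLoop a b c e ε, continuous_pageLoop _ _ _ _ _, fun z hz => ?_⟩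
    have hgz : g (pageLoop a b c e ε z) = ε * z := by
      simp only [g, pageLoop, if_true, hab.symm, hac.symm, hbc.symm, had.symm, hbd.symm, hcd.symm,
        hde, if_false]
      apply Complex.ext
      · simp; ring
      · simp
        linear_combination ε * hmaxim z.im
    refine ⟨⟨hl z hz, fun h0 => ?_⟩, hgz⟩
    rw [Set.mem_singleton_iff] at h0
    rw [h0, hgx₀] at hgz
    exact mul_ne_zero hε0 (hz0 z hz) hgz.symm

end PreAbstractSimplicialComplex

end Topology

section Triangulations

open Topology Finset

/-! ### Triangulations of surfaces -/

namespace PreAbstractSimplicialComplex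

variable {V : Type*}

lemma densityDomain_subset {K T : PreAbstractSimplicialComplex V} {r : ℕ}
    (h : ∀ i : Fin r, K.density (i + 1) ≤ T.density (i + 1)) :
    K.densityDomain r ⊆ T.densityDomain r := fun _ hα =>
  ⟨hα.1, (sum_le_sum fun i _ => ENNReal.div_le_div_left (h i) _).trans_lt hα.2⟩

open Classical in
/-- The faces of `K` with `n` vertices, as a finite set. -/
noncomputable def facesOfCard [Fintype V] (K : PreAbstractSimplicialComplex V) (n : ℕ) :
    Finset (Finset V) :=
  {s | s ∈ K.faces ∧ #s = n}

open Classical in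
/-- The vertices of `K`. -/
noncomputable def vertexFinset [Fintype V] (K : PreAbstractSimplicialComplex V) : Finset V :=
  {v | {v} ∈ K.faces}

variable [Fintype V] {K : PreAbstractSimplicialComplex V}

lemma mem_facesOfCard {n : ℕ} {s : Finset V} : s ∈ K.facesOfCard n ↔ s ∈ K.faces ∧ #s = n := by
  simp [facesOfCard]

lemma mem_vertexFinset {v : V} : v ∈ K.vertexFinset ↔ {v} ∈ K.faces := by
  simp [vertexFinset]

lemma faceCount_eq (i : ℕ) : K.faceCount i = #(K.facesOfCard (i + 1)) := by
  rw [faceCount, ← Set.ncard_coe_finset]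
  congr 1
  ext s
  simp [mem_facesOfCard]

lemma faceCount_zero : K.faceCount 0 = #K.vertexFinset := by
  rw [faceCount_eq]
  symm
  refine card_bij (fun v _ => {v}) ?_ ?_ ?_
  · intro v hv
    exact mem_facesOfCard.2 ⟨mem_vertexFinset.1 hv, card_singleton v⟩
  · intro v _ w _ h
    exact singleton_injective h
  · intro s hs
    obtain ⟨hs, hc⟩ := mem_facesOfCard.1 hs
    obtain ⟨v, rfl⟩ := card_eq_one.1 hc
    exact ⟨v, mem_vertexFinset.2 hs, rfl⟩

lemma exists_maximal_face {s : Finset V} (hs : s ∈ K.faces) :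
    ∃ t ∈ K.faces, s ⊆ t ∧ ∀ u ∈ K.faces, t ⊆ u → u ⊆ t := by
  obtain ⟨t, hst, ht⟩ := (Set.toFinite K.faces).exists_le_maximal hs
  exact ⟨t, ht.1, hst, fun u hu htu => ht.2 hu htu⟩

section Planar

variable (hK : ∀ x ∈ K.realization, PlanarAt K.realization x)
include hK

lemma planarAt_barycenter {s : Finset V} (hs : s ∈ K.faces) :
    PlanarAt K.realization (barycenter s) :=
  hK _ (mem_realization_iff.2 ⟨s, hs, barycenter_mem_closedFace (nonempty_of_mem_faces hs)⟩)

/-- A surface is purely two-dimensional. -/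
lemma card_eq_three_of_maximal {s : Finset V} (hs : s ∈ K.faces)
    (hmax : ∀ u ∈ K.faces, s ⊆ u → u ⊆ s) : #s = 3 := by
  have hpos := (nonempty_of_mem_faces hs).card_pos
  have hp := planarAt_barycenter hK hs
  by_contra h3
  rcases (by omega : #s = 1 ∨ #s = 2 ∨ 4 ≤ #s) with h | h | h
  · exact not_planarAt_of_card_one hs hmax h hp
  · exact not_planarAt_of_card_two hs hmax h hp
  · exact not_planarAt_of_four_le_card hs hmax h hp

lemma exists_triangle_of_mem_faces {s : Finset V} (hs : s ∈ K.faces) :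
    ∃ t ∈ K.faces, s ⊆ t ∧ #t = 3 := by
  obtain ⟨t, ht, hst, hmax⟩ := exists_maximal_face hs
  exact ⟨t, ht, hst, card_eq_three_of_maximal hK ht hmax⟩

lemma card_le_three {s : Finset V} (hs : s ∈ K.faces) : #s ≤ 3 := by
  obtain ⟨t, -, hst, ht⟩ := exists_triangle_of_mem_faces hK hs
  exact ht ▸ card_le_card hst

lemma card_triangles_of_edge [DecidableEq V] {e : Finset V} (he : e ∈ K.faces) (hcard : #e = 2) :
    #{t ∈ K.facesOfCard 3 | e ⊆ t} = 2 := by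
  have hp := planarAt_barycenter hK he
  obtain ⟨t, ht, het, ht3⟩ := exists_triangle_of_mem_faces hK he
  have htmem : t ∈ {t ∈ K.facesOfCard 3 | e ⊆ t} :=
    mem_filter.2 ⟨mem_facesOfCard.2 ⟨ht, ht3⟩, het⟩
  refine le_antisymm ?_ ?_
  · by_contra! hlt
    obtain ⟨t₁, t₂, t₃, h₁, h₂, h₃, h12, h13, h23⟩ := two_lt_card_iff.1 hlt
    obtain ⟨a, b, hab, rfl⟩ := card_eq_two.1 hcard
    have hpage : ∀ t ∈ {t ∈ K.facesOfCard 3 | {a, b} ⊆ t}, ∃ c, a ≠ c ∧ b ≠ c ∧ t = {a, b, c} ∧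
        {a, b, c} ∈ K.faces := by
      intro t ht
      simp only [mem_filter, mem_facesOfCard] at ht
      have h1 := card_sdiff_add_card_eq_card ht.2
      rw [card_pair hab, ht.1.2] at h1
      obtain ⟨c, hc⟩ := card_eq_one.1 (by omega : #(t \ {a, b}) = 1)
      have hcm : c ∈ t \ {a, b} := hc ▸ mem_singleton_self c
      simp only [mem_sdiff, mem_insert, mem_singleton, not_or] at hcm
      have htc : t = {a, b, c} := by
        rw [← union_sdiff_of_subset ht.2, hc]
        ext v; simp
      exact ⟨c, Ne.symm hcm.2.1, Ne.symm hcm.2.2, htc, htc ▸ ht.1.1⟩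
    obtain ⟨c, hac, hbc, rfl, hc⟩ := hpage _ h₁
    obtain ⟨d, had, hbd, rfl, hd⟩ := hpage _ h₂
    obtain ⟨f, haf, hbf, rfl, hf⟩ := hpage _ h₃
    refine not_planarAt_of_three_pages (fun t ht => card_le_three hK ht) hab hac had haf hbc hbd
      hbf ?_ ?_ ?_ hc hd hf hp
    · rintro rfl; exact h12 rfl
    · rintro rfl; exact h13 rfl
    · rintro rfl; exact h23 rfl
  · by_contra! hlt
    have huniq := card_le_one.1 (by omega : #{t ∈ K.facesOfCard 3 | e ⊆ t} ≤ 1)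
    refine not_planarAt_of_ssubset (nonempty_of_mem_faces he) ht (fun u hu heu => ?_)
      (het.ssubset_of_ne fun h => by rw [h] at hcard; omega) hp
    obtain ⟨t', ht', hut', ht'3⟩ := exists_triangle_of_mem_faces hK hu
    rwa [huniq t htmem t' (mem_filter.2 ⟨mem_facesOfCard.2 ⟨ht', ht'3⟩, heu.trans hut'⟩)]

end Planar

lemma eq_of_mem_closedFace_inter [DecidableEq V] {s t : Finset V} (hst : #(s ∩ t) ≤ 1) {x : V → ℝ}
    (hs : x ∈ closedFace s) (ht : x ∈ closedFace t) : x ∈ Set.range fun v => barycenter {v} := by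
  have hx : x ∈ closedFace (s ∩ t) := ⟨hs.1, fun v hv => mem_inter.2 ⟨hs.2 v hv, ht.2 v hv⟩⟩
  have hsum := sum_eq_one_of_mem_closedFace hx
  rcases Nat.le_one_iff_eq_zero_or_eq_one.1 hst with h | h
  · rw [card_eq_zero.1 h] at hsum
    simp at hsum
  · obtain ⟨v, hv⟩ := card_eq_one.1 h
    rw [hv] at hx hsum
    rw [sum_singleton] at hsum
    refine ⟨v, ?_⟩
    ext w
    by_cases hw : w = v
    · subst hw
      simp [barycenter, hsum]
    · have : x w = 0 := not_not.1 fun h => hw (mem_singleton.1 (hx.2 w h))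
      simp [barycenter, hw, this]

section Surface

variable {S : Type*} [TopologicalSpace S] [T2Space S] [ConnectedSpace S]
  [ChartedSpace (EuclideanSpace ℝ (Fin 2)) S]

/-- A set of triangles closed under adjacency and its complement cover the surface by two closed
sets which meet in vertices only, and finitely many points do not separate a surface. -/
lemma eq_of_closed_under_adjacency (τ : K.realization ≃ₜ S) {F : Finset (Finset V)}
    (hF : F ⊆ K.facesOfCard 3) (hne : F.Nonempty)
    (hclosed : ∀ s ∈ F, ∀ t ∈ K.facesOfCard 3, ∀ e ∈ K.facesOfCard 2, e ⊆ s → e ⊆ t → t ∈ F) :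
    F = K.facesOfCard 3 := by
  classical
  have hK : ∀ x ∈ K.realization, PlanarAt K.realization x := fun x hx => planarAt_of_homeomorph τ hx
  let A : Finset (Finset V) → Set S := fun F =>
    {x | ((τ.symm x : K.realization) : V → ℝ) ∈ ⋃ t ∈ F, closedFace t}
  have hA : ∀ F, IsClosed (A F) := fun F =>
    (F.finite_toSet.isClosed_biUnion fun t _ => isClosed_closedFace t).preimage
      (continuous_subtype_val.comp τ.symm.continuous)
  have huniv : ∀ F ⊆ K.facesOfCard 3, A F = Set.univ → F = K.facesOfCard 3 := by
    intro F hF hAF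
    refine hF.antisymm fun t ht => ?_
    obtain ⟨htK, ht3⟩ := mem_facesOfCard.1 ht
    have hx : barycenter t ∈ K.realization := mem_realization_iff.2
      ⟨t, htK, barycenter_mem_closedFace (nonempty_of_mem_faces htK)⟩
    have h1 : τ ⟨_, hx⟩ ∈ A F := hAF ▸ Set.mem_univ _
    simp only [A, Set.mem_ofPred_eq, τ.symm_apply_apply, Set.mem_iUnion] at h1
    obtain ⟨s, hs, hts⟩ := h1
    have hsub := subset_of_barycenter_mem hts
    rwa [eq_of_subset_of_card_le hsub (by rw [ht3, (mem_facesOfCard.1 (hF hs)).2])]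
  have hinter : ∀ s ∈ F, ∀ t ∈ K.facesOfCard 3 \ F, #(s ∩ t) ≤ 1 := by
    intro s hs t ht
    rw [mem_sdiff] at ht
    by_contra! hlt
    obtain ⟨e, hes, he2⟩ := exists_subset_card_eq (s := s ∩ t) (n := 2) (by omega)
    refine ht.2 (hclosed s hs t ht.1 e (mem_facesOfCard.2 ⟨?_, he2⟩)
      (hes.trans inter_subset_left) (hes.trans inter_subset_right))
    exact mem_faces_of_subset (mem_facesOfCard.1 ht.1).1 (hes.trans inter_subset_right)
      (card_pos.1 (by omega))
  have hcov : A F ∪ A (K.facesOfCard 3 \ F) = Set.univ := by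
    refine Set.eq_univ_of_forall fun x => ?_
    obtain ⟨s, hs, hxs⟩ := mem_realization_iff.1 (τ.symm x).2
    obtain ⟨t, ht, hst, ht3⟩ := exists_triangle_of_mem_faces hK hs
    have hxt := closedFace_mono hst hxs
    simp only [A, Set.mem_union, Set.mem_ofPred_eq, Set.mem_iUnion]
    by_cases htF : t ∈ F
    · exact Or.inl ⟨t, htF, hxt⟩
    · exact Or.inr ⟨t, mem_sdiff.2 ⟨mem_facesOfCard.2 ⟨ht, ht3⟩, htF⟩, hxt⟩
  have hfin : (A F ∩ A (K.facesOfCard 3 \ F)).Finite := by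
    refine Set.Finite.subset (Set.Finite.preimage (f := fun x : S => ((τ.symm x).1 : V → ℝ))
      (Subtype.val_injective.comp τ.symm.injective).injOn
      (Set.finite_range fun v : V => barycenter {v})) ?_
    rintro x ⟨hx1, hx2⟩
    simp only [A, Set.mem_ofPred_eq, Set.mem_iUnion] at hx1 hx2
    obtain ⟨s, hs, hxs⟩ := hx1
    obtain ⟨t, ht, hxt⟩ := hx2
    exact eq_of_mem_closedFace_inter (hinter s hs t ht) hxs hxt
  rcases eq_univ_or_eq_univ_of_finite_inter (hA F) (hA (K.facesOfCard 3 \ F)) hcov hfin with h | h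
  · exact huniv F hF h
  · have h1 := huniv _ sdiff_subset h
    obtain ⟨t, ht⟩ := hne
    have h2 := hF ht
    rw [← h1, mem_sdiff] at h2
    exact absurd ht h2.2

lemma isClosedTriangulation [DecidableEq V] (τ : K.realization ≃ₜ S) :
    IsClosedTriangulation K.vertexFinset (K.facesOfCard 2) (K.facesOfCard 3) := by
  have hK : ∀ x ∈ K.realization, PlanarAt K.realization x := fun x hx => planarAt_of_homeomorph τ hx
  refine ⟨fun e he => (mem_facesOfCard.1 he).2, fun t ht => (mem_facesOfCard.1 ht).2,
    fun t ht e het he2 => ?_, fun t ht v hv => ?_, fun v hv => ?_, fun e he => ?_,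
    fun F hF hne h => eq_of_closed_under_adjacency τ hF hne h⟩
  · exact mem_facesOfCard.2 ⟨mem_faces_of_subset (mem_facesOfCard.1 ht).1 het
      (card_pos.1 (by omega)), he2⟩
  · exact mem_vertexFinset.2 (mem_faces_of_subset (mem_facesOfCard.1 ht).1
      (singleton_subset_iff.2 hv) (singleton_nonempty v))
  · obtain ⟨t, ht, hvt, ht3⟩ := exists_triangle_of_mem_faces hK (mem_vertexFinset.1 hv)
    exact ⟨t, mem_facesOfCard.2 ⟨ht, ht3⟩, singleton_subset_iff.1 hvt⟩
  · have := mem_facesOfCard.1 he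
    convert card_triangles_of_edge hK this.1 this.2

end Surface

lemma eulerChar_eq (hdim : ∀ s ∈ K.faces, #s ≤ 3) (hV : 3 ≤ Fintype.card V) :
    K.eulerChar = K.faceCount 0 - K.faceCount 1 + K.faceCount 2 := by
  have hzero : ∀ i, 3 ≤ i → K.faceCount i = 0 := fun i hi => by
    rw [faceCount_eq, card_eq_zero, eq_empty_iff_forall_notMem]
    intro s hs
    obtain ⟨hs, hc⟩ := mem_facesOfCard.1 hs
    have := hdim s hs
    omega
  rw [eulerChar, ← sum_subset (range_subset_range.2 hV) fun i _ hi => ?_]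
  · simp [sum_range_succ]
    ring
  · rw [hzero i (by simpa using hi)]
    simp

lemma facesOfCard_mono {T : PreAbstractSimplicialComplex V} (hT : T ≤ K) (n : ℕ) :
    T.facesOfCard n ⊆ K.facesOfCard n := fun _ hs =>
  mem_facesOfCard.2 ⟨hT (mem_facesOfCard.1 hs).1, (mem_facesOfCard.1 hs).2⟩

lemma vertexFinset_mono {T : PreAbstractSimplicialComplex V} (hT : T ≤ K) :
    T.vertexFinset ⊆ K.vertexFinset := fun _ hv =>
  mem_vertexFinset.2 (hT (mem_vertexFinset.1 hv))

/-! ### Densities of subcomplexes -/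

section Count

variable [DecidableEq V]
  (hK : IsClosedTriangulation K.vertexFinset (K.facesOfCard 2) (K.facesOfCard 3))
  {T : PreAbstractSimplicialComplex V} (hT : T ≤ K)
include hK hT

/-- The edges of `T` avoid the vertices of `K` outside `T`, which meet their share of all edges. -/
lemma faceCount_one_mul_le (hχ : K.faceCount 1 ≤ K.faceCount 0 + K.faceCount 2) :
    T.faceCount 1 * K.faceCount 0 ≤ K.faceCount 1 * T.faceCount 0 := by
  rw [faceCount_zero, faceCount_eq, faceCount_eq] at hχ
  rw [faceCount_zero, faceCount_zero, faceCount_eq, faceCount_eq]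
  have hsub := vertexFinset_mono hT
  have key := hK.card_edges_mul_card_le hχ
    (sdiff_subset (s := K.vertexFinset) (t := T.vertexFinset))
  have h1 := card_sdiff_add_card_eq_card hsub
  have h2 : #{e ∈ K.facesOfCard 2 | ¬ Disjoint e (K.vertexFinset \ T.vertexFinset)} +
      #(T.facesOfCard 2) ≤ #(K.facesOfCard 2) := by
    rw [← card_filter_add_card_filter_not (s := K.facesOfCard 2)
      (fun e => ¬ Disjoint e (K.vertexFinset \ T.vertexFinset))]
    refine Nat.add_le_add_left (card_le_card fun e he => mem_filter.2
      ⟨facesOfCard_mono hT 2 he, not_not.2 ?_⟩) _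
    rw [disjoint_left]
    intro v hv hvn
    exact (mem_sdiff.1 hvn).2 (mem_vertexFinset.2 (mem_faces_of_subset (mem_facesOfCard.1 he).1
      (singleton_subset_iff.2 hv) (singleton_nonempty v)))
  have h3 := Nat.mul_le_mul_right #K.vertexFinset h2
  have h4 := congrArg (#(K.facesOfCard 2) * ·) h1
  simp only [Nat.reduceAdd] at *
  nlinarith

/-- In a subcomplex every edge still lies in at most two triangles. -/
lemma three_mul_faceCount_two_le : 3 * T.faceCount 2 ≤ 2 * T.faceCount 1 := by
  simp only [faceCount_eq, Nat.reduceAdd]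
  have h1 := sum_card_bipartiteAbove_eq_sum_card_bipartiteBelow (s := T.facesOfCard 2)
    (t := T.facesOfCard 3) (fun e t => e ⊆ t)
  have h2 : ∀ e ∈ T.facesOfCard 2,
      #(bipartiteAbove (fun e t => e ⊆ t) (T.facesOfCard 3) e) ≤ 2 := by
    intro e he
    rw [← hK.card_triangles_edge e (facesOfCard_mono hT 2 he)]
    exact card_le_card (filter_subset_filter _ (facesOfCard_mono hT 3))
  have h3 : ∀ t ∈ T.facesOfCard 3,
      #(bipartiteBelow (fun e t => e ⊆ t) (T.facesOfCard 2) t) = 3 := by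
    intro t ht
    obtain ⟨ht, ht3⟩ := mem_facesOfCard.1 ht
    have : bipartiteBelow (fun e t => e ⊆ t) (T.facesOfCard 2) t = powersetCard 2 t := by
      ext e
      simp only [bipartiteBelow, mem_filter, mem_powersetCard, mem_facesOfCard]
      exact ⟨fun h => ⟨h.2, h.1.2⟩, fun h => ⟨⟨mem_faces_of_subset ht h.1
        (card_pos.1 (by omega)), h.2⟩, h.1⟩⟩
    rw [this, card_powersetCard, ht3]
    rfl
  rw [sum_congr rfl h3, sum_const, smul_eq_mul] at h1
  have h4 := sum_le_sum h2
  rw [sum_const, smul_eq_mul] at h4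
  omega

lemma faceCount_two_mul_le (hχ : K.faceCount 1 ≤ K.faceCount 0 + K.faceCount 2) :
    T.faceCount 2 * K.faceCount 0 ≤ K.faceCount 2 * T.faceCount 0 := by
  have h1 := faceCount_one_mul_le hK hT hχ
  have h2 := three_mul_faceCount_two_le hK hT
  have h3 : 2 * K.faceCount 1 = 3 * K.faceCount 2 := by
    simpa only [faceCount_eq] using hK.two_mul_card_edges_eq
  have : 3 * (T.faceCount 2 * K.faceCount 0) ≤ 3 * (K.faceCount 2 * T.faceCount 0) := by
    calc 3 * (T.faceCount 2 * K.faceCount 0) = 3 * T.faceCount 2 * K.faceCount 0 := by ring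
      _ ≤ 2 * T.faceCount 1 * K.faceCount 0 := Nat.mul_le_mul_right _ h2
      _ = 2 * (T.faceCount 1 * K.faceCount 0) := by ring
      _ ≤ 2 * (K.faceCount 1 * T.faceCount 0) := Nat.mul_le_mul_left _ h1
      _ = 2 * K.faceCount 1 * T.faceCount 0 := by ring
      _ = _ := by rw [h3]; ring
  omega

end Count

lemma faceCount_zero_pos {T : PreAbstractSimplicialComplex V} (hT : T.faces.Nonempty) :
    0 < T.faceCount 0 := by
  obtain ⟨s, hs⟩ := hT
  obtain ⟨v, hv⟩ := nonempty_of_mem_faces hs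
  rw [faceCount_zero]
  exact card_pos.2 ⟨v, mem_vertexFinset.2 (mem_faces_of_subset hs (singleton_subset_iff.2 hv)
    (singleton_nonempty v))⟩

lemma density_le {T : PreAbstractSimplicialComplex V} (hT : T.faces.Nonempty) {i : ℕ}
    (h : T.faceCount i * K.faceCount 0 ≤ K.faceCount i * T.faceCount 0) :
    K.density i ≤ T.density i := by
  have h0 : (T.faceCount 0 : ℝ≥0∞) ≠ 0 := by exact_mod_cast (faceCount_zero_pos hT).ne'
  rcases Nat.eq_zero_or_pos (T.faceCount i) with hT0 | hTpos
  · have : T.density i = ⊤ := by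
      rw [density, hT0, Nat.cast_zero, ENNReal.div_zero h0]
    exact this ▸ le_top
  have hTi : (T.faceCount i : ℝ≥0∞) ≠ 0 := by exact_mod_cast hTpos.ne'
  refine ENNReal.div_le_of_le_mul ?_
  rw [density, ← ENNReal.mul_div_right_comm,
    ENNReal.le_div_iff_mul_le (Or.inl hTi) (Or.inl (ENNReal.natCast_ne_top _))]
  exact_mod_cast (mul_comm _ _).trans_le (h.trans_eq (mul_comm _ _))

end PreAbstractSimplicialComplex

end Triangulations

open Finset PreAbstractSimplicialComplex in
/-- Every triangulation `K` of a closed (compact, connected, Hausdorff) surface `S` with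
`χ(S) ≥ 0` is balanced; that is, `μ_i(T) ≥ μ_i(K)` for `i = 1, 2` and every nonempty subcomplex
`T` of `K`. -/
theorem mainTheorem3 {S : Type*} [TopologicalSpace S] [T2Space S] [CompactSpace S]
    [ConnectedSpace S] [ChartedSpace (EuclideanSpace ℝ (Fin 2)) S]
    {V : Type*} [Fintype V] (K : PreAbstractSimplicialComplex V)
    (triangulation : K.realization ≃ₜ S) (hχ : 0 ≤ K.eulerChar) :
    K.IsBalanced 2 ∧
      ∀ T : PreAbstractSimplicialComplex V, T ≤ K → T.faces.Nonempty →
        K.density 1 ≤ T.density 1 ∧ K.density 2 ≤ T.density 2 := by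
  classical
  have hplanar : ∀ x ∈ K.realization, PlanarAt K.realization x := fun x hx =>
    planarAt_of_homeomorph triangulation hx
  have hK := isClosedTriangulation triangulation
  have hdim : ∀ s ∈ K.faces, #s ≤ 3 := fun s hs => card_le_three hplanar hs
  obtain ⟨t, ht, ht3⟩ : ∃ t ∈ K.faces, #t = 3 := by
    obtain ⟨x⟩ : Nonempty S := inferInstance
    obtain ⟨s, hs, -⟩ := mem_realization_iff.1 (triangulation.symm x).2
    obtain ⟨t, ht, -, ht3⟩ := exists_triangle_of_mem_faces hplanar hs
    exact ⟨t, ht, ht3⟩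
  rw [eulerChar_eq hdim (ht3 ▸ card_le_univ t)] at hχ
  have hχ' : K.faceCount 1 ≤ K.faceCount 0 + K.faceCount 2 := by omega
  have hdens : ∀ T : PreAbstractSimplicialComplex V, T ≤ K → T.faces.Nonempty →
      K.density 1 ≤ T.density 1 ∧ K.density 2 ≤ T.density 2 := fun T hT hne =>
    ⟨density_le hne (faceCount_one_mul_le hK hT hχ'),
      density_le hne (faceCount_two_mul_le hK hT hχ')⟩
  refine ⟨⟨⟨⟨t, ht, ht3⟩, ?_⟩, ?_⟩, hdens⟩
  · rintro n ⟨s, hs, hn⟩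
    have := hdim s hs
    omega
  · refine Set.Subset.antisymm (fun α hα => hα K le_rfl ⟨t, ht⟩) fun α hα T hT hne => ?_
    refine densityDomain_subset (fun i => ?_) hα
    fin_cases i
    · exact (hdens T hT hne).1
    · exact (hdens T hT hne).2
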